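/- Let $G$ be a second countable locally compact Hausdorff group with a right Haar measure $\mu_r$, and let $\mu_l$ be the left Haar measure obtained as the image of $\mu_r$ under $x\mapsto x^{-1}$. Let $(\pi,\mathcal H)$ be a strongly continuous irreducible unitary representation of $G$ on a separable complex Hilbert space $\mathcal H\ne 0$. Inner products are linear in the first argument. Put $\mathcal W_\phi\psi(x)=\langle\psi,\pi(x)^*\phi\rangle$, and assume that $\pi$ is square integrable, i.e. $\mathcal W_\phi\phi\in L^2_r(G)=L^2(G,\mu_r)$ for some $\phi\neq 0$. Let $\mathcal S^1$ and $\mathcal S^2$ be the trace-class and the Hilbert–Schmidt operators on $\mathcal H$. There is a unique densely defined positive self-adjoint operator $\mathcal D^{-1}$ on $\mathcal H$, with domain $\{\phi : \mathcal W_\phi\psi\in L^2_r(G)\text{ for all }\psi\in\mathcal H\}$, such that $$\langle \mathcal W_{\phi_1}\psi_1,\mathcal W_{\phi_2}\psi_2\rangle_{L^2_r}=\langle\psi_1,\psi_2\rangle\,\overline{\langle\mathcal D^{-1}\phi_1,\mathcal D^{-1}\phi_2\rangle}\qquad(\phi_1,\phi_2\in\mathrm{Dom}(\mathcal D^{-1}),\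 \psi_1,\psi_2\in\mathcal H)$$ (the Duflo–Moore operator); let $\mathcal D$ be its inverse, defined on the range of $\mathcal D^{-1}$. Let $\mathcal S^1\mathcal D^{-1}\cap\mathcal S^2$ be the set of $A\in\mathcal S^2$ such that $A\mathcal D$, defined on $\mathrm{Dom}(\mathcal D)$, extends to a trace-class operator on $\mathcal H$, again written $A\mathcal D$. For such $A$ the Fourier–Wigner transform is $$\mathcal F_{\mathrm W}(A)(x)=\operatorname{tr}\big(A\mathcal D\,\pi(x)\big),\qquad x\in G .$$ For $f\in L^1_r(G)$ and $\phi\in\mathrm{Dom}(\mathcal D)$ the inverse Fourier–Wigner transform is $$\mathcal F_{\mathrm W}^{-1}(f)\phi=\pi(\check f)\mathcal D\phi=\int_G \check f(x)\,\pi(x)\mathcal D\phi\,\mathrm d\mu_l(x),\qquad \check f(x)=f(x^{-1}).$$ Then: 1. $\mathcal F_{\mathrm W}:\mathcal S^1\mathcal D^{-1}\cap\mathcal S^2\to L^2_r(G)$ has a unique extension to a continuous linear map $\mathcal F_{\mathrm W}:\mathcal S^2\to L^2_r(G)$. This extension is injective and isometric: $\|\mathcal F_{\mathrm W}(A)\|_{L^2_r}=\|A\|_{\mathcal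 S^2}$ for all $A\in\mathcal S^2$. 2. There is a unique continuous linear map $\mathcal F_{\mathrm W}^{-1}:L^2_r(G)\to\mathcal S^2$ such that, for all $f\in L^1_r(G)\cap L^2_r(G)$, the operator $\mathcal F_{\mathrm W}^{-1}(f)$ is given on $\mathrm{Dom}(\mathcal D)$ by the formula above. It is a left inverse of $\mathcal F_{\mathrm W}$: $\mathcal F_{\mathrm W}^{-1}(\mathcal F_{\mathrm W}(A))=A$ for all $A\in\mathcal S^2$. -/

import Mathlib

open MeasureTheory Topology

noncomputable section

namespace FW

section Representation

variable {G H : Type*} [Group G] [TopologicalSpace G]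
  [NormedAddCommGroup H] [InnerProductSpace ℂ H] [CompleteSpace H]

/-- Continuity of a unitary representation in the strong operator topology. -/
def IsStronglyContinuous (π : G →* unitary (H →L[ℂ] H)) : Prop :=
  ∀ φ : H, Continuous fun x : G => (π x : H →L[ℂ] H) φ

/-- Topological irreducibility: the space is non-zero and its only closed invariant subspaces
are the two trivial ones. -/
def IsIrreducible (π : G →* unitary (H →L[ℂ] H)) : Prop :=
  Nontrivial H ∧ ∀ S : Submodule ℂ H, IsClosed (S : Set H) →
    (∀ x : G, ∀ φ ∈ S, (π x : H →L[ℂ] H) φ ∈ S) → S = ⊥ ∨ S = ⊤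

/-- The wavelet transform `W_φ ψ (x) = ⟨ψ, π(x)* φ⟩`, where the bracket is linear in its first
argument (Mathlib's inner product is linear in its second argument). -/
def wavelet (π : G →* unitary (H →L[ℂ] H)) (φ ψ : H) : G → ℂ :=
  fun x => inner ℂ (ContinuousLinearMap.adjoint (π x : H →L[ℂ] H) φ) ψ

variable [MeasurableSpace G]

/-- `π` is square integrable with respect to the right Haar measure `μ`: some non-zero `φ` has
`W_φ φ ∈ L²(μ)`. -/
def IsSquareIntegrable (π : G →* unitary (H →L[ℂ] H)) (μ : Measure G) : Prop :=
  ∃ φ : H, φ ≠ 0 ∧ MemLp (wavelet π φ φ) 2 μ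

/-- `K` is the Duflo-Moore operator `𝒟⁻¹` of `π` (relative to the right Haar measure `μ`): the
densely defined, positive self-adjoint operator whose domain consists of the admissible vectors
and which satisfies
`⟨W_{φ₁} ψ₁, W_{φ₂} ψ₂⟩_{L²(μ)} = ⟨ψ₁, ψ₂⟩ * conj ⟨𝒟⁻¹ φ₁, 𝒟⁻¹ φ₂⟩`. -/
structure IsDufloMoore (π : G →* unitary (H →L[ℂ] H)) (μ : Measure G) (K : H →ₗ.[ℂ] H) :
    Prop where
  dense_domain : Dense (K.domain : Set H)
  mem_domain_iff : ∀ φ : H, φ ∈ K.domain ↔ ∀ ψ : H, MemLp (wavelet π φ ψ) 2 μ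
  isSelfAdjoint : IsSelfAdjoint K
  nonneg : ∀ φ : K.domain, 0 ≤ (inner ℂ (φ : H) (K φ)).re
  orthogonality : ∀ (φ₁ φ₂ : K.domain) (ψ₁ ψ₂ : H),
    ∫ x, wavelet π (φ₁ : H) ψ₁ x * starRingEnd ℂ (wavelet π (φ₂ : H) ψ₂ x) ∂μ =
      inner ℂ ψ₂ ψ₁ * starRingEnd ℂ (inner ℂ (K φ₂) (K φ₁))

/-- The integrated representation `π(g) φ = ∫ g(x) π(x) φ dν(x)`; here `ν` is a left Haar
measure. -/
def integratedRep (π : G →* unitary (H →L[ℂ] H)) (ν : Measure G) (g : G → ℂ) (φ : H) : H :=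
  ∫ x, g x • (π x : H →L[ℂ] H) φ ∂ν

end Representation

section Operators

variable (H : Type*) [NormedAddCommGroup H] [InnerProductSpace ℂ H] [CompleteSpace H]

/-- The index set of a fixed orthonormal basis of `H`. -/
def BasisIndex : Set H := (exists_hilbertBasis ℂ H).choose

/-- A fixed orthonormal basis of `H`. -/
def onb : HilbertBasis (BasisIndex H) ℂ H := (exists_hilbertBasis ℂ H).choose_spec.choose

variable {H}

/-- Trace-class operators: `∑ ⟨|T| eᵢ, eᵢ⟩ < ∞` with `|T| = (T* T)^{1/2}`. -/
def IsTraceClass (T : H →L[ℂ] H) : Prop :=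
  Summable fun i => (inner ℂ (onb H i) (CFC.abs T (onb H i))).re

/-- The trace `∑ ⟨T eᵢ, eᵢ⟩` (of a trace-class operator). -/
def trace (T : H →L[ℂ] H) : ℂ := ∑' i, inner ℂ (onb H i) (T (onb H i))

variable (H)

/-- The operators with `∑ ‖A eᵢ‖² < ∞`, as a subspace of the bounded operators. -/
def hsSubmodule : Submodule ℂ (H →L[ℂ] H) where
  carrier := {A | Memℓp (fun i => A (onb H i)) 2}
  zero_mem' := zero_memℓp
  add_mem' := fun ha hb => Memℓp.add ha hb
  smul_mem' := fun c _ ha => Memℓp.const_smul ha c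

/-- The space `𝒮²` of Hilbert-Schmidt operators; it is a separate type so that it carries the
Hilbert-Schmidt norm rather than the operator norm. -/
def HS : Type _ := hsSubmodule H

instance : AddCommGroup (HS H) := inferInstanceAs (AddCommGroup (hsSubmodule H))

instance : Module ℂ (HS H) := inferInstanceAs (Module ℂ (hsSubmodule H))

variable {H}

/-- The bounded operator underlying a Hilbert-Schmidt operator. -/
def HS.op (A : HS H) : H →L[ℂ] H := Subtype.val (p := fun T => T ∈ hsSubmodule H) A

variable (H)

/-- The linear map `A ↦ (A eᵢ)ᵢ` into `ℓ²`. -/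
def HS.toLp : HS H →ₗ[ℂ] lp (fun _ : BasisIndex H => H) 2 where
  toFun A := ⟨fun i => A.op (onb H i), A.2⟩
  map_add' _ _ := rfl
  map_smul' _ _ := rfl

theorem HS.toLp_injective : Function.Injective (HS.toLp H) := by
  intro A B h
  have h1 : ∀ i, A.op (onb H i) = B.op (onb H i) := fun i =>
    congrFun (congrArg Subtype.val h) i
  have h2 : A.op = B.op := by
    refine ContinuousLinearMap.ext_on (s := Set.range (onb H)) ?_ ?_
    · exact Submodule.dense_iff_topologicalClosure_eq_top.mpr (onb H).dense_span
    · rintro _ ⟨i, rfl⟩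
      exact h1 i
  exact Subtype.ext h2

/-- The Hilbert-Schmidt norm `‖A‖ = (∑ ‖A eᵢ‖²)^{1/2}`. -/
instance : NormedAddCommGroup (HS H) :=
  NormedAddCommGroup.induced (HS H) (lp (fun _ : BasisIndex H => H) 2) (HS.toLp H)
    (HS.toLp_injective H)

instance : NormedSpace ℂ (HS H) := NormedSpace.induced ℂ (HS H) _ (HS.toLp H)

variable {H}

theorem HS.norm_sq (A : HS H) : ‖A‖ ^ 2 = ∑' i, ‖A.op (onb H i)‖ ^ 2 := by
  have h := lp.norm_rpow_eq_tsum (p := 2) (by norm_num) (HS.toLp H A)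
  have h' : ‖HS.toLp H A‖ ^ 2 = ∑' i, ‖HS.toLp H A i‖ ^ 2 := by simpa using h
  exact h'

end Operators

section Transform

variable {G H : Type*} [Group G] [NormedAddCommGroup H] [InnerProductSpace ℂ H] [CompleteSpace H]

/-- The class `𝒮¹ 𝒟⁻¹ ∩ 𝒮²`: the Hilbert-Schmidt operators `A` such that `A 𝒟`, defined on
`Dom 𝒟`, extends to a trace-class operator on `H`. Here `K` is the operator `𝒟⁻¹`. -/
def S1Dinv (K : H →ₗ.[ℂ] H) : Set (HS H) :=
  {A | ∃ T : H →L[ℂ] H, IsTraceClass T ∧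
    ∀ φ : K.inverse.domain, T (φ : H) = A.op (K.inverse φ)}

/-- The Fourier-Wigner transform `F_W(A)(x) = tr(A 𝒟 π(x))`, where `A 𝒟` is the trace-class
extension given by membership in `𝒮¹ 𝒟⁻¹`. -/
def fourierWigner (π : G →* unitary (H →L[ℂ] H)) (K : H →ₗ.[ℂ] H) (A : HS H)
    (hA : A ∈ S1Dinv K) : G → ℂ :=
  fun x => trace (hA.choose * (π x : H →L[ℂ] H))

/-- The inverse Fourier-Wigner transform `F_W⁻¹(f) φ = π(f̌) 𝒟 φ` with `f̌(x) = f(x⁻¹)`, for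
`φ ∈ Dom 𝒟`; the left Haar measure is the image of the right Haar measure `μ` under `x ↦ x⁻¹`. -/
def invFourierWigner [MeasurableSpace G] (π : G →* unitary (H →L[ℂ] H)) (μ : Measure G)
    (K : H →ₗ.[ℂ] H) (f : G → ℂ) (φ : K.inverse.domain) : H :=
  integratedRep π μ.inv (fun x => f x⁻¹) (K.inverse φ)

/-- The continuous linear map `V : 𝒮² → L²(μ)` extends the Fourier-Wigner transform. -/
def ExtendsFW [MeasurableSpace G] (π : G →* unitary (H →L[ℂ] H)) (μ : Measure G)
    (K : H →ₗ.[ℂ] H) (V : HS H →L[ℂ] Lp ℂ 2 μ) : Prop :=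
  ∀ (A : HS H) (hA : A ∈ S1Dinv K), (V A : G → ℂ) =ᵐ[μ] fourierWigner π K A hA

/-- The continuous linear map `U : L²(μ) → 𝒮²` extends the inverse Fourier-Wigner transform given
by the integral formula on `L¹(μ) ∩ L²(μ)`. -/
def ExtendsInvFW [MeasurableSpace G] (π : G →* unitary (H →L[ℂ] H)) (μ : Measure G)
    (K : H →ₗ.[ℂ] H) (U : Lp ℂ 2 μ →L[ℂ] HS H) : Prop :=
  ∀ f : Lp ℂ 2 μ, Integrable (f : G → ℂ) μ → ∀ φ : K.inverse.domain,
    (U f).op (φ : H) = invFourierWigner π μ K f φ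

end Transform

end FW

end

/-! Write `K` for the Duflo–Moore operator 𝒟⁻¹. For fixed `φ`, the map `ψ ↦ W_φ ψ` is a closed
operator into L², and right invariance of `μ` makes its domain and its form invariant under `π`. A
version of Schur's lemma for closed operators then shows that one non-trivial square integrable
coefficient `W_φ ψ` makes all `W_φ ψ'` square integrable, with ⟨W_φ ψ₁, W_φ ψ₂⟩ a multiple of ⟨ψ₁,
ψ₂⟩. Polarization yields the orthogonality relations for two admissible vectors. For a fixed unit
vector `ψ`, `K` is the absolute value of the closed operator sending `φ` to the conjugate of `W_φ
ψ`. Absolute values and their uniqueness come from the bounded operator (1 + T*T)⁻¹, which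
determines the domain and the form of a closed `T`, and determines `T` itself if `T` is positive
self-adjoint.

Since `K` is injective with dense range, `K φ ↦ W_φ` extends to an antilinear map J (`transform`)
with ⟨J(v₁)ψ₁, J(v₂)ψ₂⟩ = ⟨ψ₁, ψ₂⟩⟨v₂, v₁⟩, brackets linear in the first slot. Hence A ↦ ∑ J(eᵢ)(A
eᵢ) is an isometry 𝒮² → L², and its adjoint is a left inverse. If A𝒟 extends to a trace-class `T`,
then self-adjointness of `K` gives K T* = A*, so the terms of the series tr(T π(x)) are the wavelet
transforms J(A* eᵢ)eᵢ. The series converges pointwise to the trace and in L² to the image of `A`.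
The formula for the inverse is checked weakly, against vectors of H. Both uniqueness claims are
density arguments. -/

noncomputable section

namespace FW

/-! ### Absolute values of closed operators -/

section UnboundedOperators

variable {H E F : Type*} [NormedAddCommGroup H] [InnerProductSpace ℂ H] [CompleteSpace H]
  [NormedAddCommGroup E] [InnerProductSpace ℂ E] [CompleteSpace E]
  [NormedAddCommGroup F] [InnerProductSpace ℂ F] [CompleteSpace F]

/-- `B = (1 + T* T)⁻¹` and `Q = T (1 + T* T)⁻¹`, characterized through the graph of `T`. -/
structure IsGraphResolvent (T : H →ₗ.[ℂ] E) (B : H →L[ℂ] H) (Q : H →L[ℂ] E) : Prop where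
  mem_graph : ∀ u, (B u, Q u) ∈ T.graph
  inner_add : ∀ u (φ : T.domain),
    inner ℂ (B u) (φ : H) + inner ℂ (Q u) (T φ) = inner ℂ u (φ : H)

/-- The graph is a Hilbert space because `T` is closed. With p, q its coordinate projections, take B
= p p* and Q = q p*; the inner product identity is the adjoint relation for p. Since p is injective,
p* has dense range, so the pairs (B u, Q u) are dense in the graph. -/
theorem exists_isGraphResolvent {T : H →ₗ.[ℂ] E} (hT : T.IsClosed) :
    ∃ (B : H →L[ℂ] H) (Q : H →L[ℂ] E), IsGraphResolvent T B Q ∧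
      ∀ φ : T.domain, ((φ : H), T φ) ∈ closure (Set.range fun u => (B u, Q u)) := by
  let e := WithLp.prodContinuousLinearEquiv 2 ℂ H E
  let Γ : Submodule ℂ (WithLp 2 (H × E)) := T.graph.comap (e : WithLp 2 (H × E) →ₗ[ℂ] H × E)
  have hΓ : IsClosed (Γ : Set (WithLp 2 (H × E))) := IsClosed.preimage e.continuous hT
  have : CompleteSpace Γ := hΓ.completeSpace_coe
  let p : Γ →L[ℂ] H := (WithLp.fstL 2 ℂ H E) ∘L Γ.subtypeL
  let q : Γ →L[ℂ] E := (WithLp.sndL 2 ℂ H E) ∘L Γ.subtypeL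
  have hmem : ∀ g : Γ, (p g, q g) ∈ T.graph := fun g => g.2
  let ps := ContinuousLinearMap.adjoint p
  have hps : ∀ u (g : Γ), inner ℂ (p (ps u)) (p g) + inner ℂ (q (ps u)) (q g) = inner ℂ u (p g) := by
    intro u g
    have h := ContinuousLinearMap.adjoint_inner_left p g u
    rw [← h]
    exact (WithLp.prod_inner_apply (𝕜 := ℂ) ((ps u : Γ) : WithLp 2 (H × E)) g).symm
  let mkΓ : T.domain → Γ := fun φ => ⟨e.symm ((φ : H), T φ), by
    show e (e.symm ((φ : H), T φ)) ∈ T.graph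
    rw [e.apply_symm_apply]
    exact T.mem_graph φ⟩
  refine ⟨p ∘L ps, q ∘L ps, ⟨fun u => hmem _, fun u φ => hps u (mkΓ φ)⟩, fun φ => ?_⟩
  have hker : p.ker = ⊥ := by
    rw [LinearMap.ker_eq_bot']
    intro g hg
    have h1 := hmem g
    have hg' : p g = 0 := hg
    have h2 : q g = 0 := T.graph_fst_eq_zero_snd h1 hg'
    apply Subtype.ext
    apply e.injective
    exact Prod.ext hg' h2
  have hdense : Dense (Set.range ps) := by
    have h1 : ps.rangeᗮ = ⊥ := by
      rw [ContinuousLinearMap.orthogonal_range, ContinuousLinearMap.adjoint_adjoint, hker]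
    rw [← Submodule.topologicalClosure_eq_top_iff] at h1
    have := Submodule.dense_iff_topologicalClosure_eq_top.mpr h1
    exact this
  have h3 : mkΓ φ ∈ closure (Set.range ps) := hdense _
  have h4 : Continuous fun g : Γ => (p g, q g) := p.continuous.prodMk q.continuous
  have h5 := image_closure_subset_closure_image h4 (Set.mem_image_of_mem _ h3)
  rw [← Set.range_comp] at h5
  exact h5

namespace IsGraphResolvent

variable {T : H →ₗ.[ℂ] E} {B : H →L[ℂ] H} {Q : H →L[ℂ] E}

/-- The pair (B v - w, Q v - η) lies in the graph and is orthogonal to the graph, hence vanishes. -/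
theorem apply_eq (h : IsGraphResolvent T B Q) {v w : H} {η : E} (hw : (w, η) ∈ T.graph)
    (hv : ∀ φ : T.domain, inner ℂ w (φ : H) + inner ℂ η (T φ) = inner ℂ v (φ : H)) :
    B v = w ∧ Q v = η := by
  have hd : (B v - w, Q v - η) ∈ T.graph := T.graph.sub_mem (h.mem_graph v) hw
  obtain ⟨φ, h1, h2⟩ := T.mem_graph_iff.mp hd
  have h3 := h.inner_add v φ
  rw [← hv φ, ← sub_eq_zero, add_sub_add_comm, ← inner_sub_left, ← inner_sub_left, h1, h2] at h3
  have h4 := congrArg Complex.re h3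
  simp only [Complex.add_re, Complex.zero_re] at h4
  have e1 : (inner ℂ (B v - w) (B v - w)).re = ‖B v - w‖ ^ 2 := by
    simp [inner_self_eq_norm_sq_to_K, ← Complex.ofReal_pow]
  have e2 : (inner ℂ (Q v - η) (Q v - η)).re = ‖Q v - η‖ ^ 2 := by
    simp [inner_self_eq_norm_sq_to_K, ← Complex.ofReal_pow]
  rw [e1, e2] at h4
  have h5 : ‖B v - w‖ = 0 := by nlinarith [sq_nonneg ‖B v - w‖, sq_nonneg ‖Q v - η‖]
  have h6 : ‖Q v - η‖ = 0 := by nlinarith [sq_nonneg ‖B v - w‖, sq_nonneg ‖Q v - η‖]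
  exact ⟨sub_eq_zero.mp (norm_eq_zero.mp h5), sub_eq_zero.mp (norm_eq_zero.mp h6)⟩

theorem eq_of (h : IsGraphResolvent T B Q) {B' : H →L[ℂ] H} {Q' : H →L[ℂ] E}
    (h' : IsGraphResolvent T B' Q') : B = B' ∧ Q = Q' := by
  have := fun v => h.apply_eq (h'.mem_graph v) (h'.inner_add v)
  exact ⟨ContinuousLinearMap.ext fun v => (this v).1, ContinuousLinearMap.ext fun v => (this v).2⟩

theorem mem_closure (h : IsGraphResolvent T B Q) (hT : T.IsClosed) (φ : T.domain) :
    ((φ : H), T φ) ∈ closure (Set.range fun u => (B u, Q u)) := by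
  obtain ⟨B', Q', h', hc⟩ := exists_isGraphResolvent hT
  obtain ⟨rfl, rfl⟩ := h.eq_of h'
  exact hc φ

theorem exists_seq (h : IsGraphResolvent T B Q) (hT : T.IsClosed) (φ : T.domain) :
    ∃ u : ℕ → H, Filter.Tendsto (fun n => B (u n)) Filter.atTop (𝓝 (φ : H)) ∧
      Filter.Tendsto (fun n => Q (u n)) Filter.atTop (𝓝 (T φ)) := by
  obtain ⟨x, hx, hlim⟩ := mem_closure_iff_seq_limit.mp (h.mem_closure hT φ)
  choose u hu using hx
  refine ⟨u, ?_, ?_⟩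
  · refine ((continuous_fst.tendsto _).comp hlim).congr fun n => ?_
    simp [← hu n]
  · refine ((continuous_snd.tendsto _).comp hlim).congr fun n => ?_
    simp [← hu n]

theorem inner_add_apply (h : IsGraphResolvent T B Q) (u v : H) :
    inner ℂ (B u) (B v) + inner ℂ (Q u) (Q v) = inner ℂ u (B v) := by
  obtain ⟨φ, h1, h2⟩ := T.mem_graph_iff.mp (h.mem_graph v)
  have := h.inner_add u φ
  rwa [h1, h2] at this

theorem isSymmetric (h : IsGraphResolvent T B Q) (u v : H) :
    inner ℂ (B u) v = inner ℂ u (B v) := by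
  rw [← h.inner_add_apply u v, ← inner_conj_symm, ← h.inner_add_apply v u, map_add,
    inner_conj_symm, inner_conj_symm]

theorem re_inner_eq (h : IsGraphResolvent T B Q) (u : H) :
    (inner ℂ u (B u)).re = ‖B u‖ ^ 2 + ‖Q u‖ ^ 2 := by
  rw [← h.inner_add_apply u u]
  simp [inner_self_eq_norm_sq_to_K, ← Complex.ofReal_pow]

theorem norm_apply_le (h : IsGraphResolvent T B Q) (u : H) : ‖B u‖ ≤ ‖u‖ := by
  have h1 := h.re_inner_eq u
  have h2 : (inner ℂ u (B u)).re ≤ ‖u‖ * ‖B u‖ := re_inner_le_norm (𝕜 := ℂ) u (B u)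
  by_contra! hlt
  nlinarith [norm_nonneg u, sq_nonneg ‖Q u‖]

theorem nonneg (h : IsGraphResolvent T B Q) : 0 ≤ B := by
  rw [ContinuousLinearMap.nonneg_iff_isPositive, ContinuousLinearMap.isPositive_def]
  refine ⟨fun u v => h.isSymmetric u v, fun u => ?_⟩
  rw [ContinuousLinearMap.reApplyInnerSelf_apply, inner_re_symm]
  have := h.re_inner_eq u
  simp only [RCLike.re_to_complex]
  rw [this]
  positivity

theorem le_one (h : IsGraphResolvent T B Q) : 0 ≤ 1 - B := by
  rw [ContinuousLinearMap.nonneg_iff_isPositive, ContinuousLinearMap.isPositive_def]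
  refine ⟨fun u v => ?_, fun u => ?_⟩
  · simpa [inner_sub_left, inner_sub_right] using h.isSymmetric u v
  · rw [ContinuousLinearMap.reApplyInnerSelf_apply, inner_re_symm]
    simp only [sub_apply, one_apply_eq_self, inner_sub_right,
      map_sub, inner_self_eq_norm_sq, sub_nonneg]
    have h2 : (inner ℂ u (B u)).re ≤ ‖u‖ * ‖B u‖ := re_inner_le_norm (𝕜 := ℂ) u (B u)
    have := h.norm_apply_le u
    simp only [RCLike.re_to_complex]
    nlinarith [norm_nonneg u]

theorem eq_zero_of_apply_eq_zero (h : IsGraphResolvent T B Q) (hd : Dense (T.domain : Set H))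
    {u : H} (hu : B u = 0) : u = 0 := by
  have hQ : Q u = 0 := T.graph_fst_eq_zero_snd (h.mem_graph u) hu
  refine hd.eq_zero_of_inner_left ℂ fun φ hφ => ?_
  rw [← h.inner_add u ⟨φ, hφ⟩, hu, hQ]
  simp

/-- The form domain and the form of a closed operator are determined by `(1 + T* T)⁻¹`. -/
theorem exists_seq_of_eq (h : IsGraphResolvent T B Q) (hT : T.IsClosed) {T' : H →ₗ.[ℂ] F}
    {Q' : H →L[ℂ] F} (h' : IsGraphResolvent T' B Q') (hT' : T'.IsClosed) (φ : T.domain) :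
    ∃ (hφ : (φ : H) ∈ T'.domain) (u : ℕ → H),
      Filter.Tendsto (fun n => Q (u n)) Filter.atTop (𝓝 (T φ)) ∧
      Filter.Tendsto (fun n => Q' (u n)) Filter.atTop (𝓝 (T' ⟨φ, hφ⟩)) := by
  obtain ⟨u, hu1, hu2⟩ := h.exists_seq hT φ
  -- Since ‖Q v‖² = ⟨v, B v⟩ - ‖B v‖² depends on `B` alone, Cauchy sequences `Q (u n)` give Cauchy
  -- sequences `Q' (u n)`.
  have hnorm : ∀ v, ‖Q' v‖ = ‖Q v‖ := fun v => by
    have h1 := h.re_inner_eq v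
    have h2 := h'.re_inner_eq v
    have h3 : ‖Q' v‖ ^ 2 = ‖Q v‖ ^ 2 := by linarith
    exact (sq_eq_sq₀ (norm_nonneg _) (norm_nonneg _)).mp h3
  have hc : CauchySeq fun n => Q' (u n) := by
    have hc1 := hu2.cauchySeq
    rw [Metric.cauchySeq_iff] at hc1 ⊢
    intro ε hε
    obtain ⟨N, hN⟩ := hc1 ε hε
    refine ⟨N, fun m hm n hn => ?_⟩
    have := hN m hm n hn
    rwa [dist_eq_norm, ← map_sub, hnorm, map_sub, ← dist_eq_norm]
  obtain ⟨η, hη⟩ := cauchySeq_tendsto_of_complete hc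
  have hg : ((φ : H), η) ∈ T'.graph :=
    hT'.mem_of_tendsto (hu1.prodMk_nhds hη) (Filter.Eventually.of_forall fun n => h'.mem_graph _)
  have hφ : (φ : H) ∈ T'.domain := T'.mem_domain_of_mem_graph hg
  have hval : T' ⟨φ, hφ⟩ = η := T'.mem_graph_snd_inj (T'.mem_graph ⟨φ, hφ⟩) hg rfl
  exact ⟨hφ, u, hu2, hval ▸ hη⟩

theorem domain_eq (h : IsGraphResolvent T B Q) (hT : T.IsClosed) {T' : H →ₗ.[ℂ] F}
    {Q' : H →L[ℂ] F} (h' : IsGraphResolvent T' B Q') (hT' : T'.IsClosed) :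
    T.domain = T'.domain := by
  apply le_antisymm
  · intro φ hφ
    exact (h.exists_seq_of_eq hT h' hT' ⟨φ, hφ⟩).1
  · intro φ hφ
    exact (h'.exists_seq_of_eq hT' h hT ⟨φ, hφ⟩).1

theorem inner_eq (h : IsGraphResolvent T B Q) (hT : T.IsClosed) {T' : H →ₗ.[ℂ] F}
    {Q' : H →L[ℂ] F} (h' : IsGraphResolvent T' B Q') (hT' : T'.IsClosed)
    {φ ψ : H} (hφ : φ ∈ T.domain) (hψ : ψ ∈ T.domain) (hφ' : φ ∈ T'.domain) (hψ' : ψ ∈ T'.domain) :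
    inner ℂ (T ⟨φ, hφ⟩) (T ⟨ψ, hψ⟩) = inner ℂ (T' ⟨φ, hφ'⟩) (T' ⟨ψ, hψ'⟩) := by
  obtain ⟨_, u, hu1, hu2⟩ := h.exists_seq_of_eq hT h' hT' ⟨φ, hφ⟩
  obtain ⟨_, v, hv1, hv2⟩ := h.exists_seq_of_eq hT h' hT' ⟨ψ, hψ⟩
  refine tendsto_nhds_unique (hu1.inner hv1) ((hu2.inner hv2).congr fun n => ?_)
  have h1 := h.inner_add_apply (u n) (v n)
  rw [← h'.inner_add_apply (u n) (v n)] at h1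
  exact (add_left_cancel h1).symm

end IsGraphResolvent

/-- The positive self-adjoint operator `C S⁻¹` for commuting positive `S`, `C` with
`S² + C² = 1` and `S` injective. -/
def quotientOp (S C : H →L[ℂ] H) (hS : Function.Injective S) : H →ₗ.[ℂ] H where
  domain := LinearMap.range (S : H →ₗ[ℂ] H)
  toFun := (C : H →ₗ[ℂ] H) ∘ₗ
    (LinearEquiv.ofInjective (S : H →ₗ[ℂ] H) hS).symm.toLinearMap

theorem quotientOp_apply (S C : H →L[ℂ] H) (hS : Function.Injective S) (u : H)
    (hu : S u ∈ (quotientOp S C hS).domain) : quotientOp S C hS ⟨S u, hu⟩ = C u := by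
  show C ((LinearEquiv.ofInjective (S : H →ₗ[ℂ] H) hS).symm ⟨S u, hu⟩) = C u
  congr 1
  rw [LinearEquiv.symm_apply_eq]
  rfl

theorem mem_quotientOp_domain (S C : H →L[ℂ] H) (hS : Function.Injective S) (u : H) :
    S u ∈ (quotientOp S C hS).domain := ⟨u, rfl⟩

theorem exists_quotientOp_eq (S C : H →L[ℂ] H) (hS : Function.Injective S)
    (φ : (quotientOp S C hS).domain) : ∃ u, (φ : H) = S u ∧ quotientOp S C hS φ = C u := by
  obtain ⟨_, u, rfl⟩ := φ
  exact ⟨u, rfl, quotientOp_apply S C hS u _⟩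

theorem inner_eq_of_nonneg {S : H →L[ℂ] H} (hS : 0 ≤ S) (u v : H) :
    inner ℂ (S u) v = inner ℂ u (S v) := by
  rw [ContinuousLinearMap.nonneg_iff_isPositive, ContinuousLinearMap.isPositive_def] at hS
  exact hS.1 u v

theorem dense_range_of_nonneg {S : H →L[ℂ] H} (hS : 0 ≤ S) (hinj : Function.Injective S) :
    Dense (LinearMap.range (S : H →ₗ[ℂ] H) : Set H) := by
  rw [Submodule.dense_iff_topologicalClosure_eq_top, Submodule.topologicalClosure_eq_top_iff,
    Submodule.eq_bot_iff]
  intro w hw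
  rw [Submodule.mem_orthogonal] at hw
  apply hinj
  rw [map_zero]
  refine ext_inner_left ℂ fun v => ?_
  rw [← inner_eq_of_nonneg hS, inner_zero_right]
  exact hw _ ⟨v, rfl⟩

/-- If the adjoint sends y to z, then S z = C y. The vector u = S y + C z then satisfies S u = y and
C u = z because S² + C² = 1, so (y, z) already lies in the graph of C S⁻¹. -/
theorem isSelfAdjoint_quotientOp {S C : H →L[ℂ] H} (hinj : Function.Injective S)
    (hS : 0 ≤ S) (hC : 0 ≤ C) (hcomm : Commute S C) (hone : S * S + C * C = 1) :
    IsSelfAdjoint (quotientOp S C hinj) := by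
  have hSC : ∀ u, S (C u) = C (S u) := fun u => DFunLike.congr_fun hcomm u
  have h1 : ∀ u, S (S u) + C (C u) = u := fun u => DFunLike.congr_fun hone u
  have hd : Dense ((quotientOp S C hinj).domain : Set H) := dense_range_of_nonneg hS hinj
  rw [LinearPMap.isSelfAdjoint_def]
  apply le_antisymm
  · have key : ∀ y : (LinearPMap.adjoint (quotientOp S C hinj)).domain,
        S (S y + C (LinearPMap.adjoint (quotientOp S C hinj) y)) = y ∧
        C (S y + C (LinearPMap.adjoint (quotientOp S C hinj) y)) =
          LinearPMap.adjoint (quotientOp S C hinj) y := by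
      intro y
      set z := LinearPMap.adjoint (quotientOp S C hinj) y with hz
      have h2 : S z = C y := by
        refine ext_inner_right ℂ fun u => ?_
        have := LinearPMap.adjoint_isFormalAdjoint hd y ⟨S u, mem_quotientOp_domain S C hinj u⟩
        rw [quotientOp_apply] at this
        rw [inner_eq_of_nonneg hS, inner_eq_of_nonneg hC]
        exact this
      constructor
      · rw [map_add, hSC, h2, h1]
      · rw [map_add, ← hSC, ← h2, h1]
    refine ⟨fun y hy => ?_, fun y x hxy => ?_⟩
    · have h2 := (key ⟨y, hy⟩).1
      simp only at h2
      rw [← h2]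
      exact mem_quotientOp_domain S C hinj _
    · obtain ⟨hk1, hk2⟩ := key y
      have hx : x = ⟨S (S y + C (LinearPMap.adjoint (quotientOp S C hinj) y)),
        mem_quotientOp_domain S C hinj _⟩ := Subtype.ext (by rw [← hxy]; exact hk1.symm)
      rw [hx, quotientOp_apply, hk2]
  · apply LinearPMap.IsFormalAdjoint.le_adjoint hd
    intro φ ψ
    obtain ⟨x, hx, hx'⟩ := exists_quotientOp_eq S C hinj φ
    obtain ⟨y, hy, hy'⟩ := exists_quotientOp_eq S C hinj ψ
    rw [hx, hx', hy, hy', inner_eq_of_nonneg hC, inner_eq_of_nonneg hS, hSC]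

/-- Every closed densely defined operator `T` has an absolute value: a positive self-adjoint
operator with the same domain and the same form `⟨T φ, T ψ⟩`. -/
theorem exists_abs_of_isClosed {T : H →ₗ.[ℂ] E} (hT : T.IsClosed) (hd : Dense (T.domain : Set H)) :
    ∃ K : H →ₗ.[ℂ] H, IsSelfAdjoint K ∧ (∀ φ : K.domain, 0 ≤ (inner ℂ (φ : H) (K φ)).re) ∧
      K.domain = T.domain ∧ ∀ φ ψ (hφ : φ ∈ K.domain) (hψ : ψ ∈ K.domain) (hφ' : φ ∈ T.domain)
        (hψ' : ψ ∈ T.domain), inner ℂ (K ⟨φ, hφ⟩) (K ⟨ψ, hψ⟩) = inner ℂ (T ⟨φ, hφ'⟩) (T ⟨ψ, hψ'⟩) := by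
  obtain ⟨B, Q, h, -⟩ := exists_isGraphResolvent hT
  -- As B = (1 + T*T)⁻¹, formally |T| = (1 - B)^{1/2} B^{-1/2}.
  set S := CFC.sqrt B with hSdef
  set C := CFC.sqrt (1 - B) with hCdef
  have hS : 0 ≤ S := CFC.sqrt_nonneg _
  have hC : 0 ≤ C := CFC.sqrt_nonneg _
  have hSS : S * S = B := CFC.sqrt_mul_sqrt_self B h.nonneg
  have hCC : C * C = 1 - B := CFC.sqrt_mul_sqrt_self _ h.le_one
  have hcomm : Commute S C := by
    have h1 : Commute B (1 - B) := (Commute.one_right B).sub_right (Commute.refl B)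
    have h2 : Commute S (1 - B) := h1.cfcₙ_nnreal NNReal.sqrt
    exact (h2.symm.cfcₙ_nnreal NNReal.sqrt).symm
  have hone : S * S + C * C = 1 := by rw [hSS, hCC]; abel
  have hinj : Function.Injective S := by
    rw [injective_iff_map_eq_zero]
    intro u hu
    apply h.eq_zero_of_apply_eq_zero hd
    rw [← hSS, mul_apply_eq_comp, hu, map_zero]
  let K := quotientOp S C hinj
  have hK : IsSelfAdjoint K := isSelfAdjoint_quotientOp hinj hS hC hcomm hone
  -- `K` shares the resolvent `B` with `T`, and `B` determines both the domain and the form.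
  have hres : IsGraphResolvent K B (C * S) := by
    refine ⟨fun u => ?_, ?_⟩
    · rw [LinearPMap.mem_graph_iff]
      refine ⟨⟨S (S u), mem_quotientOp_domain S C hinj _⟩, ?_, quotientOp_apply S C hinj _ _⟩
      rw [← hSS]; rfl
    · intro u φ
      obtain ⟨v, hv, hv'⟩ := exists_quotientOp_eq S C hinj φ
      rw [hv, hv', ← hSS, mul_apply_eq_comp, mul_apply_eq_comp, inner_eq_of_nonneg hS (S u),
        inner_eq_of_nonneg hC, ← inner_add_right,
        show S (S v) + C (C v) = v from DFunLike.congr_fun hone v, inner_eq_of_nonneg hS]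
  refine ⟨K, hK, ?_, hres.domain_eq hK.isClosed h hT, fun φ ψ hφ hψ hφ' hψ' =>
    hres.inner_eq hK.isClosed h hT hφ hψ hφ' hψ'⟩
  intro φ
  obtain ⟨u, hu, hu'⟩ := exists_quotientOp_eq S C hinj φ
  rw [hu, hu', inner_eq_of_nonneg hS]
  have h1 : 0 ≤ S * C := hcomm.mul_nonneg hS hC
  rw [ContinuousLinearMap.nonneg_iff_isPositive, ContinuousLinearMap.isPositive_def] at h1
  have h2 := h1.2 u
  rw [ContinuousLinearMap.reApplyInnerSelf_apply, inner_re_symm] at h2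
  exact h2

theorem inner_symm_of_isSelfAdjoint {K : H →ₗ.[ℂ] H} (hK : IsSelfAdjoint K) (x y : K.domain) :
    inner ℂ (K x) (y : H) = inner ℂ (x : H) (K y) := by
  have h := LinearPMap.adjoint_isFormalAdjoint hK.dense_domain
  rw [LinearPMap.isSelfAdjoint_def.mp hK] at h
  exact h x y

theorem mem_graph_of_isSelfAdjoint {K : H →ₗ.[ℂ] H} (hK : IsSelfAdjoint K) {y z : H}
    (h : ∀ x : K.domain, inner ℂ z (x : H) = inner ℂ y (K x)) : (y, z) ∈ K.graph := by
  have h1 : y ∈ (LinearPMap.adjoint K).domain :=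
    LinearPMap.mem_adjoint_domain_of_exists y ⟨z, h⟩
  have h2 := LinearPMap.adjoint_apply_eq hK.dense_domain ⟨y, h1⟩ h
  have h3 := (LinearPMap.adjoint K).mem_graph ⟨y, h1⟩
  rw [h2] at h3
  have h4 := congrArg LinearPMap.graph (LinearPMap.isSelfAdjoint_def.mp hK)
  exact h4 ▸ h3

/-- Here Q = K B and K Q = 1 - B, so Q² = B - B². Positivity of `Q` follows from ⟨Q u, u⟩ = ⟨Q u, B
u⟩ + ⟨Q u, K Q u⟩, both terms having non-negative real part; the positive square root is unique. -/
theorem IsGraphResolvent.eq_sqrt {K : H →ₗ.[ℂ] H} (hK : IsSelfAdjoint K)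
    (hpos : ∀ φ : K.domain, 0 ≤ (inner ℂ (φ : H) (K φ)).re) {B Q : H →L[ℂ] H}
    (h : IsGraphResolvent K B Q) : Q = CFC.sqrt (B - B * B) := by
  have hB : ∀ u, ∃ φ : K.domain, (φ : H) = B u ∧ K φ = Q u := fun u =>
    K.mem_graph_iff.mp (h.mem_graph u)
  have hQ : ∀ u, ∃ φ : K.domain, (φ : H) = Q u ∧ K φ = u - B u := fun u => by
    refine K.mem_graph_iff.mp (mem_graph_of_isSelfAdjoint hK fun x => ?_)
    rw [inner_sub_left, ← h.inner_add u x, add_sub_cancel_left]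
  have hQQ : Q * Q = B - B * B := by
    ext u
    -- The characterization of `B` and `Q` at `Q u` gives B Q u = Q B u together with the required
    -- value of Q Q u.
    refine (h.apply_eq (v := Q u) (w := Q (B u)) (η := B u - B (B u)) ?_ fun φ => ?_).2
    · obtain ⟨φ, h1, h2⟩ := hQ (B u)
      exact K.mem_graph_iff.mpr ⟨φ, h1, h2⟩
    · obtain ⟨b, hb1, hb2⟩ := hB u
      obtain ⟨b', hb1', hb2'⟩ := hB (B u)
      rw [inner_sub_left, ← hb1', ← hb1, ← inner_symm_of_isSelfAdjoint hK,
        ← inner_symm_of_isSelfAdjoint hK, hb2, hb1, hb2']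
      ring
  have hsymm : ∀ u v, inner ℂ (Q u) v = inner ℂ u (Q v) := by
    intro u v
    obtain ⟨b, hb1, hb2⟩ := hB u
    obtain ⟨c, hc1, hc2⟩ := hB v
    obtain ⟨q, hq1, hq2⟩ := hQ u
    obtain ⟨r, hr1, hr2⟩ := hQ v
    have e1 := inner_symm_of_isSelfAdjoint hK b c
    have e2 := inner_symm_of_isSelfAdjoint hK q r
    rw [hb1, hb2, hc1, hc2] at e1
    rw [hq1, hq2, hr1, hr2, inner_sub_left, inner_sub_right] at e2
    linear_combination e1 - e2
  refine (CFC.sqrt_unique hQQ ?_).symm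
  rw [ContinuousLinearMap.nonneg_iff_isPositive, ContinuousLinearMap.isPositive_def]
  refine ⟨hsymm, fun u => ?_⟩
  obtain ⟨b, hb1, hb2⟩ := hB u
  obtain ⟨q, hq1, hq2⟩ := hQ u
  have p1 := hpos b
  have p2 := hpos q
  rw [hb1, hb2] at p1
  rw [hq1, hq2, inner_sub_right, Complex.sub_re] at p2
  rw [ContinuousLinearMap.reApplyInnerSelf_apply]
  show 0 ≤ (inner ℂ (Q u) u).re
  have e3 : (inner ℂ (Q u) (B u)).re = (inner ℂ (B u) (Q u)).re := inner_re_symm (𝕜 := ℂ) _ _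
  linarith

/-- A positive self-adjoint operator is determined by its domain and its form. -/
theorem eq_of_form_eq {K K' : H →ₗ.[ℂ] H} (hK : IsSelfAdjoint K) (hK' : IsSelfAdjoint K')
    (hpos : ∀ φ : K.domain, 0 ≤ (inner ℂ (φ : H) (K φ)).re)
    (hpos' : ∀ φ : K'.domain, 0 ≤ (inner ℂ (φ : H) (K' φ)).re)
    (hdom : K.domain = K'.domain)
    (hform : ∀ φ ψ (hφ : φ ∈ K.domain) (hψ : ψ ∈ K.domain) (hφ' : φ ∈ K'.domain)
      (hψ' : ψ ∈ K'.domain),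
      inner ℂ (K ⟨φ, hφ⟩) (K ⟨ψ, hψ⟩) = inner ℂ (K' ⟨φ, hφ'⟩) (K' ⟨ψ, hψ'⟩)) : K = K' := by
  obtain ⟨B, Q, h, hc⟩ := exists_isGraphResolvent hK.isClosed
  obtain ⟨B', Q', h', hc'⟩ := exists_isGraphResolvent hK'.isClosed
  -- The identity characterizing `B` involves `K` only through its domain and form. Positivity then
  -- fixes `Q`, and each graph is the closure of the same set of pairs.
  have hBB : B' = B := by
    ext v
    obtain ⟨b, hb1, hb2⟩ := K.mem_graph_iff.mp (h.mem_graph v)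
    have hb' : (b : H) ∈ K'.domain := by rw [← hdom]; exact b.2
    have := (h'.apply_eq (K'.mem_graph ⟨b, hb'⟩) (v := v) fun φ => ?_).1
    · rw [this]; exact hb1
    · have hφ : (φ : H) ∈ K.domain := by rw [hdom]; exact φ.2
      rw [← h.inner_add v ⟨φ, hφ⟩, ← hform b φ b.2 hφ hb' φ.2, ← show (b : H) = B v from hb1,
        ← show K b = Q v from hb2]
  have hQQ : Q' = Q := by rw [h.eq_sqrt hK hpos, h'.eq_sqrt hK' hpos', hBB]
  subst hBB hQQ
  apply LinearPMap.eq_of_eq_graph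
  apply le_antisymm
  · rintro ⟨x, y⟩ hxy
    obtain ⟨φ, rfl, rfl⟩ := K.mem_graph_iff.mp hxy
    refine closure_minimal ?_ hK'.isClosed (hc φ)
    rintro _ ⟨u, rfl⟩
    exact h'.mem_graph u
  · rintro ⟨x, y⟩ hxy
    obtain ⟨φ, rfl, rfl⟩ := K'.mem_graph_iff.mp hxy
    refine closure_minimal ?_ hK.isClosed (hc' φ)
    rintro _ ⟨u, rfl⟩
    exact h.mem_graph u

end UnboundedOperators

/-! ### Schur's lemma, bounded and unbounded -/

section Schur

variable {G H E : Type*} [Group G] [NormedAddCommGroup H] [InnerProductSpace ℂ H] [CompleteSpace H]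
  [NormedAddCommGroup E] [InnerProductSpace ℂ E] [CompleteSpace E]

theorem rep_mul_apply (π : G →* unitary (H →L[ℂ] H)) (x y : G) (u : H) :
    (π (x * y) : H →L[ℂ] H) u = (π x : H →L[ℂ] H) ((π y : H →L[ℂ] H) u) := by
  rw [map_mul]; rfl

theorem rep_one_apply (π : G →* unitary (H →L[ℂ] H)) (u : H) :
    (π 1 : H →L[ℂ] H) u = u := by
  rw [map_one]; rfl

theorem rep_inv_apply_self (π : G →* unitary (H →L[ℂ] H)) (x : G) (u : H) :
    (π x⁻¹ : H →L[ℂ] H) ((π x : H →L[ℂ] H) u) = u := by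
  rw [← rep_mul_apply, inv_mul_cancel, rep_one_apply]

theorem rep_apply_inv_self (π : G →* unitary (H →L[ℂ] H)) (x : G) (u : H) :
    (π x : H →L[ℂ] H) ((π x⁻¹ : H →L[ℂ] H) u) = u := by
  rw [← rep_mul_apply, mul_inv_cancel, rep_one_apply]

theorem adjoint_rep (π : G →* unitary (H →L[ℂ] H)) (x : G) :
    ContinuousLinearMap.adjoint (π x : H →L[ℂ] H) = (π x⁻¹ : H →L[ℂ] H) := by
  rw [map_inv, ← ContinuousLinearMap.star_eq_adjoint, ← Unitary.coe_star, Unitary.star_eq_inv]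

theorem inner_rep_left (π : G →* unitary (H →L[ℂ] H)) (x : G) (u v : H) :
    inner ℂ ((π x : H →L[ℂ] H) u) v = inner ℂ u ((π x⁻¹ : H →L[ℂ] H) v) := by
  rw [← adjoint_rep, ContinuousLinearMap.adjoint_inner_right]

theorem inner_rep_rep (π : G →* unitary (H →L[ℂ] H)) (x : G) (u v : H) :
    inner ℂ ((π x : H →L[ℂ] H) u) ((π x : H →L[ℂ] H) v) = inner ℂ u v := by
  rw [inner_rep_left, rep_inv_apply_self]

theorem norm_rep_apply (π : G →* unitary (H →L[ℂ] H)) (x : G) (u : H) :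
    ‖(π x : H →L[ℂ] H) u‖ = ‖u‖ := by
  rw [@norm_eq_sqrt_re_inner ℂ, inner_rep_rep, ← @norm_eq_sqrt_re_inner ℂ]

theorem wavelet_eq (π : G →* unitary (H →L[ℂ] H)) (φ ψ : H) (x : G) :
    wavelet π φ ψ x = inner ℂ φ ((π x : H →L[ℂ] H) ψ) := by
  rw [wavelet, ContinuousLinearMap.adjoint_inner_left]

/-- The operator f(B) commutes with `π`, so its kernel is a closed invariant subspace. -/
theorem cfc_eq_zero_or_injective {π : G →* unitary (H →L[ℂ] H)} (hirr : IsIrreducible π)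
    {B : H →L[ℂ] H} (hcomm : ∀ x, Commute B (π x : H →L[ℂ] H)) (f : ℝ → ℝ) :
    cfc f B = 0 ∨ Function.Injective (cfc f B : H →L[ℂ] H) := by
  have hc : ∀ x, Commute (cfc f B) (π x : H →L[ℂ] H) := fun x => (hcomm x).cfc_real f
  have hinv : ∀ x, ∀ φ ∈ (cfc f B : H →L[ℂ] H).ker,
      (π x : H →L[ℂ] H) φ ∈ (cfc f B : H →L[ℂ] H).ker := by
    intro x φ hφ
    have h1 : (cfc f B : H →L[ℂ] H) ((π x : H →L[ℂ] H) φ) = (π x : H →L[ℂ] H) (cfc f B φ) :=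
      DFunLike.congr_fun (hc x).eq φ
    have h2 : (cfc f B : H →L[ℂ] H) φ = 0 := hφ
    show (cfc f B : H →L[ℂ] H) ((π x : H →L[ℂ] H) φ) = 0
    rw [h1, h2, map_zero]
  rcases hirr.2 _ (cfc f B : H →L[ℂ] H).isClosed_ker hinv with h | h
  · right
    exact LinearMap.ker_eq_bot.mp h
  · left
    ext u
    have : u ∈ (cfc f B : H →L[ℂ] H).ker := by rw [h]; trivial
    exact this

/-- Schur's lemma for bounded self-adjoint operators. -/
theorem exists_eq_smul_of_commute {π : G →* unitary (H →L[ℂ] H)} (hirr : IsIrreducible π)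
    {B : H →L[ℂ] H} (hB : IsSelfAdjoint B) (hcomm : ∀ x, Commute B (π x : H →L[ℂ] H)) :
    ∃ c : ℝ, B = algebraMap ℝ (H →L[ℂ] H) c := by
  have : Nontrivial H := hirr.1
  obtain ⟨a, ha⟩ : (spectrum ℝ B).Nonempty := ContinuousFunctionalCalculus.spectrum_nonempty B hB
  have hne : ∀ f : ℝ → ℝ, Continuous f → ∀ t ∈ spectrum ℝ B, f t ≠ 0 → cfc f B ≠ 0 := by
    intro f hf t ht hft h0
    have h1 : f t ∈ spectrum ℝ (cfc f B) := by
      rw [cfc_map_spectrum f B hB hf.continuousOn]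
      exact ⟨t, ht, rfl⟩
    rw [h0, spectrum.zero_eq] at h1
    exact hft h1
  have hlt : ∀ s ∈ spectrum ℝ B, ∀ t ∈ spectrum ℝ B, ¬ s < t := by
    intro s hs t ht hst
    -- Two spectral values would give non-zero f(B) and g(B), with f and g supported on opposite
    -- sides of the midpoint. Their product is zero, contradicting injectivity of f(B).
    let m := (s + t) / 2
    let f : ℝ → ℝ := fun r => max (m - r) 0
    let g : ℝ → ℝ := fun r => max (r - m) 0
    have hf : Continuous f := by fun_prop
    have hg : Continuous g := by fun_prop
    have hf0 : cfc f B ≠ 0 := hne f hf s hs (by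
      have : 0 < m - s := by simp only [m]; linarith
      simp [f, this.le, this.ne'])
    have hg0 : cfc g B ≠ 0 := hne g hg t ht (by
      have : 0 < t - m := by simp only [m]; linarith
      simp [g, this.le, this.ne'])
    have hfg : cfc f B * cfc g B = 0 := by
      rw [← cfc_mul f g B hf.continuousOn hg.continuousOn]
      have : (fun r => f r * g r) = fun _ => 0 := by
        funext r
        rcases le_total r m with h | h
        · simp [g, h]
        · simp [f, h]
      rw [this, cfc_const_zero]
    apply hg0
    ext u
    apply (cfc_eq_zero_or_injective hirr hcomm f).resolve_left hf0
    rw [zero_apply (F := H →L[ℂ] H), map_zero]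
    exact DFunLike.congr_fun hfg u
  refine ⟨a, ?_⟩
  conv_lhs => rw [← cfc_id ℝ B hB]
  rw [cfc_congr (g := fun _ => a), cfc_const a B hB]
  intro t ht
  exact le_antisymm (not_lt.mp (hlt a ha t ht)) (not_lt.mp (hlt t ht a ha))

/-- Schur's lemma for closed operators `T`: an invariant domain and an invariant form
`⟨T φ, T ψ⟩` force `T` to be everywhere defined and a multiple of an isometry. -/
theorem domain_eq_top_of_invariant {π : G →* unitary (H →L[ℂ] H)} (hirr : IsIrreducible π)
    {T : H →ₗ.[ℂ] E} (hT : T.IsClosed) (hne : ∃ φ ∈ T.domain, φ ≠ 0)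
    (hinv : ∀ x, ∀ φ ∈ T.domain, (π x : H →L[ℂ] H) φ ∈ T.domain)
    (hform : ∀ x φ ψ (hφ : φ ∈ T.domain) (hψ : ψ ∈ T.domain),
      inner ℂ (T ⟨(π x : H →L[ℂ] H) φ, hinv x φ hφ⟩) (T ⟨(π x : H →L[ℂ] H) ψ, hinv x ψ hψ⟩) =
        inner ℂ (T ⟨φ, hφ⟩) (T ⟨ψ, hψ⟩)) :
    T.domain = ⊤ ∧ ∃ c : ℂ, ∀ φ ψ : T.domain, inner ℂ (T φ) (T ψ) = c * inner ℂ (φ : H) (ψ : H) := by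
  obtain ⟨B, Q, h, -⟩ := exists_isGraphResolvent hT
  have hsa : IsSelfAdjoint B := IsSelfAdjoint.of_nonneg h.nonneg
  -- By invariance of the form, π(x) B u solves the equation characterizing B π(x) u.
  have hcomm : ∀ x, Commute B (π x : H →L[ℂ] H) := by
    intro x
    ext u
    obtain ⟨b, hb1, hb2⟩ := T.mem_graph_iff.mp (h.mem_graph u)
    have hb1 : (b : H) = B u := hb1
    have hb2 : T b = Q u := hb2
    have key := (h.apply_eq (v := (π x : H →L[ℂ] H) u)
      (T.mem_graph ⟨(π x : H →L[ℂ] H) b, hinv x b b.2⟩) fun φ => ?_).1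
    · show B ((π x : H →L[ℂ] H) u) = (π x : H →L[ℂ] H) (B u)
      rw [key, ← hb1]
    · have hψ := hinv x⁻¹ φ φ.2
      have e1 : φ = ⟨(π x : H →L[ℂ] H) ((π x⁻¹ : H →L[ℂ] H) φ), hinv x _ hψ⟩ :=
        Subtype.ext (rep_apply_inv_self π x φ).symm
      rw [e1, hform x b _ b.2 hψ]
      simp only
      rw [inner_rep_rep, inner_rep_rep, ← h.inner_add u ⟨_, hψ⟩, ← hb1, ← hb2]
  obtain ⟨c, hc⟩ := exists_eq_smul_of_commute hirr hsa hcomm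
  have hBu : ∀ u, B u = (c : ℂ) • u := by
    intro u
    rw [hc, Algebra.algebraMap_eq_smul_one]
    simp
  have hc0 : (c : ℂ) ≠ 0 := by
    intro h0
    obtain ⟨φ, hφ, hφ0⟩ := hne
    apply hφ0
    have hB0 : B φ = 0 := by rw [hBu, h0, zero_smul]
    have hQ0 : Q φ = 0 := T.graph_fst_eq_zero_snd (h.mem_graph φ) hB0
    have := h.inner_add φ ⟨φ, hφ⟩
    rw [hB0, hQ0, inner_zero_left, inner_zero_left, add_zero] at this
    exact inner_self_eq_zero.mp this.symm
  have htop : T.domain = ⊤ := by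
    rw [Submodule.eq_top_iff']
    intro φ
    have h1 := T.mem_domain_of_mem_graph (h.mem_graph ((c : ℂ)⁻¹ • φ))
    rwa [hBu, smul_smul, mul_inv_cancel₀ hc0, one_smul] at h1
  -- With u = c⁻¹ φ one has B u = φ, so the identity for `B` reads ⟨φ, ψ⟩ + ⟨T φ, T ψ⟩ = c⁻¹ ⟨φ, ψ⟩.
  refine ⟨htop, (c : ℂ)⁻¹ - 1, fun φ ψ => ?_⟩
  obtain ⟨b, hb1, hb2⟩ := T.mem_graph_iff.mp (h.mem_graph ((c : ℂ)⁻¹ • (φ : H)))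
  have hb1 : (b : H) = B ((c : ℂ)⁻¹ • (φ : H)) := hb1
  have hb2 : T b = Q ((c : ℂ)⁻¹ • (φ : H)) := hb2
  have hbφ : b = φ := by
    apply Subtype.ext
    rw [hb1, hBu, smul_smul, mul_inv_cancel₀ hc0, one_smul]
  have h1 := h.inner_add ((c : ℂ)⁻¹ • (φ : H)) ψ
  rw [← hb1, ← hb2, hbφ, inner_smul_left, ← Complex.ofReal_inv, Complex.conj_ofReal] at h1
  rw [← Complex.ofReal_inv]
  linear_combination h1

end Schur

/-! ### Closed operators given by coefficient functions -/

section CoefficientOperators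

variable {G H : Type*} [MeasurableSpace G] [NormedAddCommGroup H] [InnerProductSpace ℂ H]

/-- The operator sending `h` to the function `x ↦ ℓ x h`, defined where this is in `L²`. -/
def coeffOp (μ : Measure G) (ℓ : G → H →L[ℂ] ℂ) : H →ₗ.[ℂ] Lp ℂ 2 μ where
  domain :=
    { carrier := {h | MemLp (fun x => ℓ x h) 2 μ}
      zero_mem' := by simp
      add_mem' := fun {a b} ha hb => by
        have h : MemLp (fun x => ℓ x a + ℓ x b) 2 μ := MemLp.add ha hb
        simpa using h
      smul_mem' := fun c a ha => by
        have h : MemLp (fun x => c • ℓ x a) 2 μ := MemLp.const_smul ha c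
        simpa using h }
  toFun :=
    { toFun := fun h => MemLp.toLp (fun x => ℓ x (h : H)) h.2
      map_add' := fun a b => by
        rw [← MemLp.toLp_add]
        congr 1
        funext x
        simp
      map_smul' := fun c a => by
        rw [RingHom.id_apply, ← MemLp.toLp_const_smul]
        congr 1
        funext x
        simp }

theorem mem_coeffOp_domain {μ : Measure G} {ℓ : G → H →L[ℂ] ℂ} {h : H} :
    h ∈ (coeffOp μ ℓ).domain ↔ MemLp (fun x => ℓ x h) 2 μ := Iff.rfl

theorem coeffOp_ae_eq {μ : Measure G} {ℓ : G → H →L[ℂ] ℂ} (h : (coeffOp μ ℓ).domain) :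
    (coeffOp μ ℓ h : G → ℂ) =ᵐ[μ] fun x => ℓ x h :=
  MemLp.coeFn_toLp h.2

theorem inner_coeffOp {μ : Measure G} {ℓ : G → H →L[ℂ] ℂ} (h k : (coeffOp μ ℓ).domain) :
    inner ℂ (coeffOp μ ℓ h) (coeffOp μ ℓ k) = ∫ x, ℓ x k * starRingEnd ℂ (ℓ x h) ∂μ := by
  rw [L2.inner_def]
  refine integral_congr_ae ?_
  filter_upwards [coeffOp_ae_eq h, coeffOp_ae_eq k] with x hx hy
  rw [hx, hy]
  rfl

/-- An L² limit is an almost everywhere limit along a subsequence, and continuity of each `ℓ x`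
identifies that limit pointwise. -/
theorem coeffOp_isClosed (μ : Measure G) (ℓ : G → H →L[ℂ] ℂ) : (coeffOp μ ℓ).IsClosed := by
  refine IsSeqClosed.isClosed fun z p hz hlim => ?_
  have h1 : Filter.Tendsto (fun n => (z n).1) Filter.atTop (𝓝 p.1) :=
    (continuous_fst.tendsto _).comp hlim
  have h2 : Filter.Tendsto (fun n => (z n).2) Filter.atTop (𝓝 p.2) :=
    (continuous_snd.tendsto _).comp hlim
  obtain ⟨ns, hns, hae⟩ := (tendstoInMeasure_of_tendsto_Lp h2).exists_seq_tendsto_ae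
  have h3 : ∀ n, ((z n).2 : G → ℂ) =ᵐ[μ] fun x => ℓ x (z n).1 := by
    intro n
    obtain ⟨φ, hφ1, hφ2⟩ := (coeffOp μ ℓ).mem_graph_iff.mp (hz n)
    rw [← hφ1, ← hφ2]
    exact coeffOp_ae_eq φ
  have h4 : (p.2 : G → ℂ) =ᵐ[μ] fun x => ℓ x p.1 := by
    filter_upwards [hae, ae_all_iff.mpr h3] with x hx hx3
    refine tendsto_nhds_unique hx ?_
    have h5 := (((ℓ x).continuous.tendsto _).comp h1).comp hns.tendsto_atTop
    refine h5.congr fun n => ?_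
    exact (hx3 (ns n)).symm
  have h6 : MemLp (fun x => ℓ x p.1) 2 μ := (memLp_congr_ae h4).mp (Lp.memLp p.2)
  refine (coeffOp μ ℓ).mem_graph_iff.mpr ⟨⟨p.1, h6⟩, rfl, ?_⟩
  exact Lp.ext ((coeffOp_ae_eq _).trans h4.symm)

end CoefficientOperators

/-! ### Left translates of a right Haar measure -/

section Translation

variable {G : Type*} [Group G] [TopologicalSpace G] [IsTopologicalGroup G]
  [LocallyCompactSpace G] [SecondCountableTopology G] [MeasurableSpace G] [BorelSpace G]

/-- Inversion turns `μ` into a left Haar measure and left translation by `a` into right translation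
by `a⁻¹`. A right translate of a left Haar measure is again left invariant, so uniqueness of Haar
measure applies. -/
theorem exists_map_mul_left_eq_smul (μ : Measure G) [μ.IsMulRightInvariant]
    [IsFiniteMeasureOnCompacts μ] [μ.IsOpenPosMeasure] (a : G) :
    ∃ c : NNReal, μ.map (fun x => a * x) = c • μ := by
  have : μ.inv.IsHaarMeasure := {}
  have h1 := Measure.isMulLeftInvariant_eq_smul (μ.inv.map (fun x => x * a⁻¹)) μ.inv
  refine ⟨(μ.inv.map (fun x => x * a⁻¹)).haarScalarFactor μ.inv, ?_⟩
  · have h2 : μ.map (fun x => a * x) = (μ.inv.map (fun x => x * a⁻¹)).map Inv.inv := by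
      rw [Measure.inv_def, Measure.map_map (measurable_mul_const _) measurable_inv,
        Measure.map_map measurable_inv ((measurable_mul_const _).comp measurable_inv)]
      congr 1
      funext x
      simp
    rw [h2]
    conv_lhs => rw [h1]
    rw [Measure.map_smul, ← Measure.inv_def, Measure.inv_inv]

theorem memLp_comp_mul_left {μ : Measure G} [μ.IsMulRightInvariant]
    [IsFiniteMeasureOnCompacts μ] [μ.IsOpenPosMeasure] {f : G → ℂ} (hf : MemLp f 2 μ) (a : G) :
    MemLp (fun x => f (a * x)) 2 μ := by
  obtain ⟨c, hc⟩ := exists_map_mul_left_eq_smul μ a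
  have h1 : MemLp f 2 (μ.map (fun x => a * x)) := by
    rw [hc]
    exact hf.smul_measure (by simp)
  exact h1.comp_of_map (measurable_const_mul a).aemeasurable

end Translation

/-! ### Orthogonality relations and the Duflo–Moore operator -/

section DufloMoore

variable {G H : Type*} [Group G] [TopologicalSpace G] [IsTopologicalGroup G]
  [MeasurableSpace G] [BorelSpace G]
  [NormedAddCommGroup H] [InnerProductSpace ℂ H] [CompleteSpace H]
  {π : G →* unitary (H →L[ℂ] H)} {μ : Measure G}

theorem continuous_wavelet (hcont : IsStronglyContinuous π) (φ ψ : H) :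
    Continuous (wavelet π φ ψ) := by
  have h : wavelet π φ ψ = fun x => inner ℂ φ ((π x : H →L[ℂ] H) ψ) :=
    funext fun x => wavelet_eq π φ ψ x
  rw [h]
  exact continuous_const.inner (hcont ψ)

theorem wavelet_rep_right (φ ψ : H) (x y : G) :
    wavelet π φ ((π y : H →L[ℂ] H) ψ) x = wavelet π φ ψ (x * y) := by
  rw [wavelet_eq, wavelet_eq, rep_mul_apply]

theorem wavelet_rep_left (φ ψ : H) (x y : G) :
    wavelet π ((π y : H →L[ℂ] H) φ) ψ x = wavelet π φ ψ (y⁻¹ * x) := by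
  rw [wavelet_eq, wavelet_eq, rep_mul_apply, inner_rep_left]

/-- Square integrability of a single non-trivial coefficient `W_φ ψ` gives the orthogonality
relations for all coefficients with the same `φ`. -/
theorem exists_orthogonality_of_memLp [μ.IsMulRightInvariant] (hirr : IsIrreducible π) {φ ψ : H}
    (hψ : ψ ≠ 0) (h : MemLp (wavelet π φ ψ) 2 μ) :
    (∀ ψ', MemLp (wavelet π φ ψ') 2 μ) ∧ ∃ c : ℂ, ∀ ψ₁ ψ₂,
      ∫ x, wavelet π φ ψ₁ x * starRingEnd ℂ (wavelet π φ ψ₂ x) ∂μ = c * inner ℂ ψ₂ ψ₁ := by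
  let ℓ : G → H →L[ℂ] ℂ := fun x => (innerSL ℂ φ) ∘L (π x : H →L[ℂ] H)
  have hℓ : ∀ ψ', (fun x => ℓ x ψ') = wavelet π φ ψ' := fun ψ' =>
    funext fun x => (wavelet_eq π φ ψ' x).symm
  have hdom : ∀ ψ', ψ' ∈ (coeffOp μ ℓ).domain ↔ MemLp (wavelet π φ ψ') 2 μ := fun ψ' => by
    rw [mem_coeffOp_domain, hℓ]
  have hinv : ∀ x, ∀ ψ' ∈ (coeffOp μ ℓ).domain,
      (π x : H →L[ℂ] H) ψ' ∈ (coeffOp μ ℓ).domain := by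
    intro y ψ' h'
    rw [hdom] at h' ⊢
    refine (h'.comp_measurePreserving (measurePreserving_mul_right μ y)).congr_norm ?_ ?_
    · have := (h'.comp_measurePreserving (measurePreserving_mul_right μ y)).1
      convert this using 1
      funext x
      exact wavelet_rep_right φ ψ' x y
    · refine Filter.Eventually.of_forall fun x => ?_
      rw [wavelet_rep_right]
      rfl
  have hint : ∀ a b : (coeffOp μ ℓ).domain, inner ℂ (coeffOp μ ℓ a) (coeffOp μ ℓ b) =
      ∫ x, wavelet π φ b x * starRingEnd ℂ (wavelet π φ a x) ∂μ := by
    intro a b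
    rw [inner_coeffOp]
    congr 1
    funext x
    rw [wavelet_eq, wavelet_eq]
    rfl
  -- Acting by `π y` on ψ is right translation of `W_φ ψ` by `y`, which preserves `μ`; so domain and
  -- form are invariant.
  obtain ⟨htop, c, hc⟩ := domain_eq_top_of_invariant hirr (coeffOp_isClosed μ ℓ)
    ⟨ψ, (hdom ψ).mpr h, hψ⟩ hinv (by
      intro y a b ha hb
      rw [hint, hint]
      simp only [wavelet_rep_right]
      exact integral_mul_right_eq_self
        (fun x => wavelet π φ b x * starRingEnd ℂ (wavelet π φ a x)) y)
  have hall : ∀ ψ', ψ' ∈ (coeffOp μ ℓ).domain := fun ψ' => by rw [htop]; trivial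
  refine ⟨fun ψ' => (hdom ψ').mp (hall ψ'), c, fun ψ₁ ψ₂ => ?_⟩
  rw [← hc ⟨ψ₂, hall ψ₂⟩ ⟨ψ₁, hall ψ₁⟩, hint]

variable (π μ)

/-- The admissible vectors. -/
def admissible : Submodule ℂ H where
  carrier := {φ | ∀ ψ : H, MemLp (wavelet π φ ψ) 2 μ}
  zero_mem' := fun ψ => by
    have : wavelet π 0 ψ = fun _ => 0 := by funext x; simp [wavelet_eq]
    rw [this]
    exact MemLp.zero
  add_mem' := fun {a b} ha hb ψ => by
    have : wavelet π (a + b) ψ = wavelet π a ψ + wavelet π b ψ := by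
      funext x; simp [wavelet_eq]
    rw [this]
    exact (ha ψ).add (hb ψ)
  smul_mem' := fun c a ha ψ => by
    have : wavelet π (c • a) ψ = starRingEnd ℂ c • wavelet π a ψ := by
      funext x; simp [wavelet_eq, mul_comm]
    rw [this]
    exact (ha ψ).const_smul _

/-- The wavelet transform with an admissible vector, as an element of `L²`. -/
def waveletLp : admissible π μ →ₛₗ[starRingEnd ℂ] H →ₗ[ℂ] Lp ℂ 2 μ :=
  LinearMap.mk₂'ₛₗ (starRingEnd ℂ) (RingHom.id ℂ)
    (fun φ ψ => MemLp.toLp (wavelet π (φ : H) ψ) (φ.2 ψ))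
    (fun a b ψ => by
      rw [← MemLp.toLp_add]
      congr 1
      funext x; simp [wavelet_eq])
    (fun c a ψ => by
      rw [← MemLp.toLp_const_smul]
      congr 1
      funext x; simp [wavelet_eq, mul_comm])
    (fun a ψ ψ' => by
      rw [← MemLp.toLp_add]
      congr 1
      funext x; simp [wavelet_eq])
    (fun c a ψ => by
      rw [RingHom.id_apply, ← MemLp.toLp_const_smul]
      congr 1
      funext x; simp [wavelet_eq])

variable {π μ}

theorem waveletLp_ae_eq (φ : admissible π μ) (ψ : H) :
    (waveletLp π μ φ ψ : G → ℂ) =ᵐ[μ] wavelet π φ ψ :=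
  MemLp.coeFn_toLp (φ.2 ψ)

theorem inner_waveletLp (φ φ' : admissible π μ) (ψ ψ' : H) :
    inner ℂ (waveletLp π μ φ' ψ') (waveletLp π μ φ ψ) =
      ∫ x, wavelet π φ ψ x * starRingEnd ℂ (wavelet π φ' ψ' x) ∂μ := by
  rw [L2.inner_def]
  refine integral_congr_ae ?_
  filter_upwards [waveletLp_ae_eq φ ψ, waveletLp_ae_eq φ' ψ'] with x hx hy
  rw [hx, hy]
  rfl

theorem mem_admissible_of_memLp [μ.IsMulRightInvariant] (hirr : IsIrreducible π) {φ ψ : H}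
    (hψ : ψ ≠ 0) (h : MemLp (wavelet π φ ψ) 2 μ) : φ ∈ admissible π μ :=
  (exists_orthogonality_of_memLp hirr hψ h).1

theorem exists_orthogonality [μ.IsMulRightInvariant] (hirr : IsIrreducible π)
    (φ₁ φ₂ : admissible π μ) :
    ∃ c : ℂ, ∀ ψ₁ ψ₂,
      inner ℂ (waveletLp π μ φ₂ ψ₂) (waveletLp π μ φ₁ ψ₁) = c * inner ℂ ψ₂ ψ₁ := by
  obtain ⟨ψ, hψ⟩ : ∃ ψ : H, ψ ≠ 0 := by
    have := hirr.1
    exact exists_ne 0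
  have key : ∀ φ : admissible π μ, ∃ c : ℂ, ∀ ψ₁ ψ₂,
      inner ℂ (waveletLp π μ φ ψ₂) (waveletLp π μ φ ψ₁) = c * inner ℂ ψ₂ ψ₁ := by
    intro φ
    obtain ⟨c, hc⟩ := (exists_orthogonality_of_memLp hirr hψ (φ.2 ψ)).2
    exact ⟨c, fun ψ₁ ψ₂ => by rw [inner_waveletLp, hc]⟩
  obtain ⟨c₁, h₁⟩ := key (φ₁ + φ₂)
  obtain ⟨c₂, h₂⟩ := key (φ₁ - φ₂)
  obtain ⟨c₃, h₃⟩ := key (φ₁ + Complex.I • φ₂)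
  obtain ⟨c₄, h₄⟩ := key (φ₁ - Complex.I • φ₂)
  -- Polarization. The left side is linear in `φ₂` and antilinear in `φ₁`, which fixes the sign of
  -- the imaginary part.
  refine ⟨(c₁ - c₂ + Complex.I * (c₄ - c₃)) / 4, fun ψ₁ ψ₂ => ?_⟩
  have e₁ := h₁ ψ₁ ψ₂
  have e₂ := h₂ ψ₁ ψ₂
  have e₃ := h₃ ψ₁ ψ₂
  have e₄ := h₄ ψ₁ ψ₂
  simp only [map_add, map_sub, map_smulₛₗ, LinearMap.add_apply, LinearMap.sub_apply,
    LinearMap.smul_apply, inner_add_left, inner_add_right, inner_sub_left, inner_sub_right,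
    inner_smul_left, inner_smul_right, Complex.conj_I, map_neg] at e₁ e₂ e₃ e₄
  linear_combination (e₁ - e₂ + Complex.I * (e₄ - e₃)) / 4 +
    (inner ℂ (waveletLp π μ φ₂ ψ₂) (waveletLp π μ φ₁ ψ₁) -
      inner ℂ (waveletLp π μ φ₁ ψ₂) (waveletLp π μ φ₂ ψ₁)) / 2 * Complex.I_sq

/-- Left translation scales `μ` by a constant, so admissibility is invariant under `π`. The closure
of the admissible vectors is therefore a closed invariant subspace, non-zero by square
integrability. -/
theorem dense_admissible [LocallyCompactSpace G] [SecondCountableTopology G]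
    [μ.IsMulRightInvariant] [IsFiniteMeasureOnCompacts μ] [μ.IsOpenPosMeasure]
    (hirr : IsIrreducible π) (hsq : IsSquareIntegrable π μ) :
    Dense (admissible π μ : Set H) := by
  obtain ⟨φ, hφ0, hφ⟩ := hsq
  have hmem : φ ∈ admissible π μ := mem_admissible_of_memLp hirr hφ0 hφ
  have hinv : ∀ x, ∀ φ ∈ admissible π μ, (π x : H →L[ℂ] H) φ ∈ admissible π μ := by
    intro y φ hφ ψ
    have h1 := memLp_comp_mul_left (hφ ψ) y⁻¹
    have h2 : wavelet π ((π y : H →L[ℂ] H) φ) ψ = fun x => wavelet π φ ψ (y⁻¹ * x) :=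
      funext fun x => wavelet_rep_left φ ψ x y
    rw [h2]
    exact h1
  rw [Submodule.dense_iff_topologicalClosure_eq_top]
  refine (hirr.2 (admissible π μ).topologicalClosure
    (admissible π μ).isClosed_topologicalClosure fun x φ' hφ' => ?_).resolve_left fun h => ?_
  · exact map_mem_closure (π x : H →L[ℂ] H).continuous hφ' (hinv x)
  · have h1 := (admissible π μ).le_topologicalClosure hmem
    rw [h] at h1
    exact hφ0 ((Submodule.mem_bot ℂ).mp h1)

theorem IsDufloMoore.domain_eq {K : H →ₗ.[ℂ] H} (hK : IsDufloMoore π μ K) :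
    K.domain = admissible π μ :=
  Submodule.ext hK.mem_domain_iff

theorem exists_isDufloMoore [LocallyCompactSpace G] [SecondCountableTopology G]
    [μ.IsMulRightInvariant] [IsFiniteMeasureOnCompacts μ] [μ.IsOpenPosMeasure]
    (hirr : IsIrreducible π) (hsq : IsSquareIntegrable π μ) :
    ∃ K : H →ₗ.[ℂ] H, IsDufloMoore π μ K := by
  have := hirr.1
  obtain ⟨ψ, hψ⟩ := exists_norm_eq H (zero_le_one' ℝ)
  have hψ0 : ψ ≠ 0 := by rintro rfl; simp at hψ
  -- Conjugating `W_φ ψ` makes it linear in `φ`. Its square integrability for this single `ψ ≠ 0`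
  -- already means that `φ` is admissible.
  let ℓ : G → H →L[ℂ] ℂ := fun x => innerSL ℂ ((π x : H →L[ℂ] H) ψ)
  have hℓ : ∀ φ, (fun x => ℓ x φ) = star (wavelet π φ ψ) := fun φ => funext fun x => by
    show inner ℂ ((π x : H →L[ℂ] H) ψ) φ = starRingEnd ℂ (wavelet π φ ψ x)
    rw [wavelet_eq, inner_conj_symm]
  have hdom : (coeffOp μ ℓ).domain = admissible π μ := by
    ext φ
    rw [mem_coeffOp_domain, hℓ]
    constructor
    · intro h
      refine mem_admissible_of_memLp hirr hψ0 ?_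
      simpa using h.star
    · intro h
      exact (h ψ).star
  obtain ⟨K, hsa, hpos, hKdom, hform⟩ := exists_abs_of_isClosed (coeffOp_isClosed μ ℓ)
    (by rw [hdom]; exact dense_admissible hirr hsq)
  have hKadm : K.domain = admissible π μ := hKdom.trans hdom
  refine ⟨K, hsa.dense_domain, fun φ => ?_, hsa, hpos, fun φ₁ φ₂ ψ₁ ψ₂ => ?_⟩
  · rw [hKadm]; rfl
  · have hm : ∀ φ : K.domain, (φ : H) ∈ admissible π μ := fun φ => by
      rw [← hKadm]; exact φ.2
    have hm' : ∀ φ : K.domain, (φ : H) ∈ (coeffOp μ ℓ).domain := fun φ => by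
      rw [← hKdom]; exact φ.2
    obtain ⟨c, hc⟩ := exists_orthogonality hirr ⟨φ₁, hm φ₁⟩ ⟨φ₂, hm φ₂⟩
    have h1 := hc ψ₁ ψ₂
    have h2 := hc ψ ψ
    rw [inner_waveletLp] at h1 h2
    rw [h1]
    -- The constant is read off at ψ₁ = ψ₂ = ψ, where the integral is the form of `coeffOp`, hence
    -- that of `K`.
    have h3 : c = inner ℂ (K φ₁) (K φ₂) := by
      rw [inner_self_eq_norm_sq_to_K, hψ] at h2
      have h4 := hform φ₁ φ₂ φ₁.2 φ₂.2 (hm' φ₁) (hm' φ₂)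
      rw [h4, inner_coeffOp]
      simp only [Complex.coe_algebraMap, Complex.ofReal_one, one_pow, mul_one] at h2
      rw [← h2]
      congr 1
      funext x
      rw [wavelet_eq, wavelet_eq, inner_conj_symm, mul_comm]
      show _ = inner ℂ ((π x : H →L[ℂ] H) ψ) _ * starRingEnd ℂ (inner ℂ ((π x : H →L[ℂ] H) ψ) _)
      rw [inner_conj_symm]
    rw [h3, inner_conj_symm, mul_comm]

theorem IsDufloMoore.unique (hirr : IsIrreducible π) {K K' : H →ₗ.[ℂ] H}
    (hK : IsDufloMoore π μ K) (hK' : IsDufloMoore π μ K') : K = K' := by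
  have := hirr.1
  obtain ⟨ψ, hψ⟩ := exists_norm_eq H (zero_le_one' ℝ)
  refine eq_of_form_eq hK.isSelfAdjoint hK'.isSelfAdjoint hK.nonneg hK'.nonneg
    (hK.domain_eq.trans hK'.domain_eq.symm) fun φ φ' hφ hφ' h h' => ?_
  have h1 := hK.orthogonality ⟨φ, hφ⟩ ⟨φ', hφ'⟩ ψ ψ
  have h2 := hK'.orthogonality ⟨φ, h⟩ ⟨φ', h'⟩ ψ ψ
  rw [inner_self_eq_norm_sq_to_K, hψ, inner_conj_symm] at h1 h2
  simp only [Complex.coe_algebraMap, Complex.ofReal_one, one_pow, one_mul] at h1 h2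
  rw [← h1, ← h2]

end DufloMoore

/-! ### Hilbert–Schmidt and trace-class operators -/

section HilbertSchmidt

variable {H : Type*} [NormedAddCommGroup H] [InnerProductSpace ℂ H] [CompleteSpace H]

/-- An operator `T` with `‖T u‖ ≤ ‖P u‖` factors through `P`. -/
theorem exists_factorization {T P : H →L[ℂ] H} (h : ∀ u, ‖T u‖ ≤ ‖P u‖) :
    ∃ J : H →L[ℂ] H, ∀ u, T u = J (P u) := by
  let R := (P : H →ₗ[ℂ] H).range.topologicalClosure
  have hR : IsClosed (R : Set H) := Submodule.isClosed_topologicalClosure _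
  have : CompleteSpace R := hR.completeSpace_coe
  let e : H →ₗ[ℂ] R := LinearMap.codRestrict R (P : H →ₗ[ℂ] H)
    fun u => Submodule.le_topologicalClosure _ ⟨u, rfl⟩
  have hd : DenseRange e := by
    intro y
    have h1 : (y : H) ∈ closure (Set.range P) := y.2
    rw [closure_subtype]
    convert h1
    ext z
    simp [e]
  have hn : ∃ C : ℝ, ∀ u, ‖(T : H →ₗ[ℂ] H) u‖ ≤ C * ‖e u‖ := ⟨1, fun u => by
    rw [one_mul]; exact h u⟩
  -- The contraction P u ↦ T u extends to the closure of the range of `P`, and by zero to its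
  -- orthogonal complement.
  refine ⟨((T : H →ₗ[ℂ] H).extendOfNorm e) ∘L R.orthogonalProjectionOnto, fun u => ?_⟩
  have h2 : R.orthogonalProjectionOnto (P u) = e u :=
    Submodule.orthogonalProjectionOnto_mem_subspace_eq_self (e u)
  rw [ContinuousLinearMap.comp_apply, h2]
  exact (LinearMap.extendOfNorm_eq hd hn u).symm

theorem mem_hsSubmodule_iff {A : H →L[ℂ] H} :
    A ∈ hsSubmodule H ↔ Summable fun i => ‖A (onb H i)‖ ^ 2 := by
  have h := memℓp_gen_iff (p := 2) (by norm_num) (f := fun i => A (onb H i))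
  refine h.trans ?_
  simp

theorem hasSum_nnnorm_sq_inner (u : H) :
    HasSum (fun i => ‖inner ℂ (onb H i) u‖₊ ^ 2) (‖u‖₊ ^ 2) := by
  have h := (onb H).hasSum_inner_mul_inner u u
  rw [← NNReal.hasSum_coe]
  have h1 := Complex.hasSum_re h
  convert h1 using 1
  · funext i
    rw [← inner_conj_symm, Complex.mul_conj, Complex.ofReal_re, Complex.normSq_eq_norm_sq]
    simpa using norm_inner_symm _ _
  · simp [inner_self_eq_norm_sq_to_K, ← Complex.ofReal_pow]

/-- Both sums equal the double sum of |⟨eⱼ, A eᵢ⟩|². In `ENNReal` the order of summation can be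
exchanged unconditionally. -/
theorem hasSum_norm_sq_adjoint {A : H →L[ℂ] H} {c : NNReal}
    (h : HasSum (fun i => ‖A (onb H i)‖₊ ^ 2) c) :
    HasSum (fun i => ‖ContinuousLinearMap.adjoint A (onb H i)‖₊ ^ 2) c := by
  rw [← ENNReal.hasSum_coe] at h ⊢
  have key : ∀ B : H →L[ℂ] H, ∀ i, ((‖B (onb H i)‖₊ ^ 2 : NNReal) : ENNReal) =
      ∑' j, ((‖inner ℂ (onb H j) (B (onb H i))‖₊ ^ 2 : NNReal) : ENNReal) := fun B i =>
    (ENNReal.hasSum_coe.mpr (hasSum_nnnorm_sq_inner (B (onb H i)))).tsum_eq.symm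
  have h1 := h.tsum_eq
  rw [← h1]
  simp_rw [key]
  rw [ENNReal.tsum_comm]
  have : ∀ i j, ‖inner ℂ (onb H j) (A (onb H i))‖₊ =
      ‖inner ℂ (onb H i) (ContinuousLinearMap.adjoint A (onb H j))‖₊ := by
    intro i j
    rw [ContinuousLinearMap.adjoint_inner_right]
    exact NNReal.eq (norm_inner_symm _ _)
  simp_rw [this]
  exact ENNReal.summable.hasSum

theorem adjoint_mem_hsSubmodule {A : H →L[ℂ] H} (h : A ∈ hsSubmodule H) :
    ContinuousLinearMap.adjoint A ∈ hsSubmodule H := by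
  rw [mem_hsSubmodule_iff] at h ⊢
  have h1 : Summable fun i => ‖A (onb H i)‖₊ ^ 2 := by
    rw [← NNReal.summable_coe]
    simpa using h
  have h2 := (hasSum_norm_sq_adjoint h1.hasSum).summable
  rw [← NNReal.summable_coe] at h2
  simpa using h2

theorem HS.hasSum_norm_sq (A : HS H) : HasSum (fun i => ‖A.op (onb H i)‖ ^ 2) (‖A‖ ^ 2) := by
  rw [HS.norm_sq]
  exact (mem_hsSubmodule_iff.mp A.2).hasSum

theorem HS.hasSum_norm_sq_adjoint (A : HS H) :
    HasSum (fun i => ‖ContinuousLinearMap.adjoint A.op (onb H i)‖ ^ 2) (‖A‖ ^ 2) := by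
  have h1 : HasSum (fun i => ‖A.op (onb H i)‖₊ ^ 2) (‖A‖₊ ^ 2) := by
    rw [← NNReal.hasSum_coe]
    simpa using A.hasSum_norm_sq
  have h2 := FW.hasSum_norm_sq_adjoint h1
  rw [← NNReal.hasSum_coe] at h2
  simpa using h2

theorem comp_mem_hsSubmodule_left {A : H →L[ℂ] H} (h : A ∈ hsSubmodule H) (J : H →L[ℂ] H) :
    J * A ∈ hsSubmodule H := by
  rw [mem_hsSubmodule_iff] at h ⊢
  refine Summable.of_nonneg_of_le (fun i => by positivity) (fun i => ?_) (h.mul_left (‖J‖ ^ 2))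
  rw [← mul_pow]
  gcongr
  exact J.le_opNorm _

theorem comp_mem_hsSubmodule_right {A : H →L[ℂ] H} (h : A ∈ hsSubmodule H) (J : H →L[ℂ] H) :
    A * J ∈ hsSubmodule H := by
  have h1 := adjoint_mem_hsSubmodule
    (comp_mem_hsSubmodule_left (adjoint_mem_hsSubmodule h) (ContinuousLinearMap.adjoint J))
  have h2 : ContinuousLinearMap.adjoint
      (ContinuousLinearMap.adjoint J * ContinuousLinearMap.adjoint A) = A * J := by
    simp only [← ContinuousLinearMap.star_eq_adjoint, star_mul, star_star]
  rwa [h2] at h1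

theorem summable_inner_of_mem_hsSubmodule {A B : H →L[ℂ] H} (hA : A ∈ hsSubmodule H)
    (hB : B ∈ hsSubmodule H) : Summable fun i => inner ℂ (A (onb H i)) (B (onb H i)) := by
  rw [mem_hsSubmodule_iff] at hA hB
  refine Summable.of_norm_bounded (hA.add hB) fun i => ?_
  refine (norm_inner_le_norm _ _).trans ?_
  nlinarith [sq_nonneg (‖A (onb H i)‖ - ‖B (onb H i)‖), sq_nonneg ‖A (onb H i)‖,
    sq_nonneg ‖B (onb H i)‖]

/-- The series defining the trace of `T U` converges for `T` of trace class. -/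
theorem IsTraceClass.summable_mul {T : H →L[ℂ] H} (hT : IsTraceClass T) (U : H →L[ℂ] H) :
    Summable fun i => inner ℂ (onb H i) ((T * U) (onb H i)) := by
  -- Factor T = J P with P = |T| = S². Trace class says that `S` is Hilbert–Schmidt, and ⟨eᵢ, T U
  -- eᵢ⟩ = ⟨S J* eᵢ, S U eᵢ⟩ pairs two Hilbert–Schmidt operators.
  set P := CFC.abs T with hP
  set S := CFC.sqrt P with hSdef
  have hP0 : 0 ≤ P := CFC.abs_nonneg T
  have hS0 : 0 ≤ S := CFC.sqrt_nonneg P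
  have hSS : S * S = P := CFC.sqrt_mul_sqrt_self P hP0
  have hPP : P * P = star T * T := CFC.abs_mul_abs T
  have hnorm : ∀ u, ‖T u‖ ≤ ‖P u‖ := by
    intro u
    have h1 : inner ℂ (T u) (T u) = inner ℂ (P u) (P u) := by
      rw [inner_eq_of_nonneg hP0, ← ContinuousLinearMap.adjoint_inner_right,
        ← ContinuousLinearMap.star_eq_adjoint]
      exact congrArg (inner ℂ u) (DFunLike.congr_fun hPP.symm u)
    rw [@norm_eq_sqrt_re_inner ℂ, h1, ← @norm_eq_sqrt_re_inner ℂ]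
  obtain ⟨J, hJ⟩ := exists_factorization hnorm
  have hShs : S ∈ hsSubmodule H := by
    rw [mem_hsSubmodule_iff]
    refine hT.congr fun i => ?_
    rw [← hP, ← hSS, mul_apply_eq_comp, ← inner_eq_of_nonneg hS0]
    simp [inner_self_eq_norm_sq_to_K, ← Complex.ofReal_pow]
  refine (summable_inner_of_mem_hsSubmodule
    (comp_mem_hsSubmodule_right hShs (ContinuousLinearMap.adjoint J))
    (comp_mem_hsSubmodule_right hShs U)).congr fun i => ?_
  rw [mul_apply_eq_comp, mul_apply_eq_comp, mul_apply_eq_comp, inner_eq_of_nonneg hS0,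
    ContinuousLinearMap.adjoint_inner_left, hJ, ← hSS]
  rfl

open InnerProductSpace in
theorem isTraceClass_rankOne (w v : H) : IsTraceClass (rankOne ℂ w v) := by
  rcases eq_or_ne v 0 with rfl | hv
  · simp [IsTraceClass]
  have hv' : ‖v‖ ≠ 0 := norm_ne_zero_iff.mpr hv
  -- The scalar is forced: T*T = ‖w‖² v⊗v for T = w⊗v, while (v⊗v)² = ‖v‖² v⊗v.
  let P : H →L[ℂ] H := ((‖w‖ / ‖v‖ : ℝ) : ℂ) • rankOne ℂ v v
  have hP0 : 0 ≤ P := by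
    rw [ContinuousLinearMap.nonneg_iff_isPositive]
    refine (isPositive_rankOne_self v).smul_of_nonneg ?_
    rw [Complex.zero_le_real]
    positivity
  have habs : CFC.abs (rankOne ℂ w v) = P := by
    refine CFC.sqrt_unique ?_ hP0
    ext u
    simp only [P, ContinuousLinearMap.star_eq_adjoint, adjoint_rankOne, mul_apply_eq_comp,
      smul_apply, rankOne_apply, inner_smul_right, inner_self_eq_norm_sq_to_K, smul_smul]
    congr 1
    simp only [Complex.coe_algebraMap]
    have : ((‖v‖ : ℝ) : ℂ) ≠ 0 := by exact_mod_cast hv'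
    push_cast
    field_simp
  rw [IsTraceClass, habs]
  have h1 := (Complex.hasSum_re ((onb H).hasSum_inner_mul_inner v v)).summable
  refine (h1.mul_left (‖w‖ / ‖v‖)).congr fun i => ?_
  simp only [P, smul_apply, rankOne_apply, inner_smul_right, Complex.re_ofReal_mul]
  
/-- The operator with columns `w i` is the adjoint of ψ ↦ ∑ ⟨w i, ψ⟩ eᵢ (inner product of Mathlib),
which is bounded by ‖w‖ by Cauchy–Schwarz in each term. -/
theorem HS.toLp_surjective : Function.Surjective (HS.toLp H) := by
  intro w
  have hw : Summable fun i => ‖w i‖ ^ 2 := by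
    simpa using (memℓp_gen_iff (p := 2) (by norm_num)).mp (lp.memℓp w)
  have hbd : ∀ (ψ : H) i, ‖inner ℂ (w i) ψ‖ ^ 2 ≤ ‖ψ‖ ^ 2 * ‖w i‖ ^ 2 := fun ψ i => by
    rw [← mul_pow, mul_comm]
    gcongr
    exact norm_inner_le_norm _ _
  have hs : ∀ ψ : H, Summable fun i => ‖inner ℂ (w i) ψ‖ ^ 2 := fun ψ =>
    Summable.of_nonneg_of_le (fun i => by positivity) (hbd ψ) (hw.mul_left _)
  have hmem : ∀ ψ : H, Memℓp (fun i => inner ℂ (w i) ψ) 2 := fun ψ =>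
    (memℓp_gen_iff (p := 2) (by norm_num)).mpr (by simpa using hs ψ)
  let L : H →ₗ[ℂ] lp (fun _ : BasisIndex H => ℂ) 2 :=
    { toFun := fun ψ => ⟨fun i => inner ℂ (w i) ψ, hmem ψ⟩
      map_add' := fun a b => by ext i; exact inner_add_right _ _ _
      map_smul' := fun c a => by ext i; exact inner_smul_right _ _ _ }
  have hL : ∀ ψ, ‖L ψ‖ ≤ ‖w‖ * ‖ψ‖ := by
    intro ψ
    have h1 : ‖L ψ‖ ^ 2 = ∑' i, ‖inner ℂ (w i) ψ‖ ^ 2 := by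
      have h : ‖L ψ‖ ^ 2 = ∑' i, ‖L ψ i‖ ^ 2 := by
        simpa using lp.norm_rpow_eq_tsum (p := 2) (by norm_num) (L ψ)
      exact h
    have h2 : ‖w‖ ^ 2 = ∑' i, ‖w i‖ ^ 2 := by
      have := lp.norm_rpow_eq_tsum (p := 2) (by norm_num) w
      simpa using this
    refine le_of_sq_le_sq ?_ (by positivity)
    rw [h1, mul_pow, h2, mul_comm, ← tsum_mul_left]
    exact (hs ψ).tsum_le_tsum (hbd ψ) (hw.mul_left _)
  let A : H →L[ℂ] H := ContinuousLinearMap.adjoint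
    (((onb H).repr.symm.toContinuousLinearEquiv : _ →L[ℂ] H) ∘L L.mkContinuous ‖w‖ hL)
  have hA : ∀ i, A (onb H i) = w i := by
    intro i
    refine ext_inner_right ℂ fun ψ => ?_
    rw [ContinuousLinearMap.adjoint_inner_left, ← (onb H).repr_apply_apply]
    simp [L]
  refine ⟨⟨A, ?_⟩, ?_⟩
  · rw [mem_hsSubmodule_iff]
    simpa [hA] using hw
  · ext i
    exact hA i

variable (H) in
/-- The identification of the Hilbert-Schmidt operators with `ℓ²`. -/
def HS.equivLp : HS H ≃ₗᵢ[ℂ] lp (fun _ : BasisIndex H => H) 2 :=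
  LinearIsometryEquiv.ofSurjective ⟨HS.toLp H, fun _ => rfl⟩ HS.toLp_surjective

theorem HS.equivLp_apply (A : HS H) (i : BasisIndex H) :
    HS.equivLp H A i = A.op (onb H i) := rfl

/-- The rank-one operator `u ↦ ⟨v, u⟩ w`, as a Hilbert-Schmidt operator. -/
def rankOneHS (w v : H) : HS H :=
  ⟨InnerProductSpace.rankOne ℂ w v, by
    rw [mem_hsSubmodule_iff]
    have h := (hasSum_nnnorm_sq_inner v).summable
    rw [← NNReal.summable_coe] at h
    refine (h.mul_left (‖w‖ ^ 2)).congr fun i => ?_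
    simp [norm_smul, mul_pow, mul_comm, norm_inner_symm v]⟩

theorem rankOneHS_op_apply (w v u : H) : (rankOneHS w v).op u = inner ℂ v u • w := rfl

theorem HS.ext_op {A B : HS H} (h : ∀ i, A.op (onb H i) = B.op (onb H i)) : A = B :=
  (HS.equivLp H).injective (lp.ext (funext h))

theorem norm_rankOneHS (w v : H) : ‖rankOneHS w v‖ = ‖w‖ * ‖v‖ := by
  have h1 := (hasSum_nnnorm_sq_inner v)
  rw [← NNReal.hasSum_coe] at h1
  have h3 := (rankOneHS w v).hasSum_norm_sq
  have h4 : (fun i => ‖(rankOneHS w v).op (onb H i)‖ ^ 2) =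
      fun i => ‖w‖ ^ 2 * ((‖inner ℂ (onb H i) v‖₊ ^ 2 : NNReal) : ℝ) := by
    funext i
    simp [rankOneHS_op_apply, norm_smul, mul_pow, mul_comm, norm_inner_symm v]
  rw [h4] at h3
  have h2 := (h1.mul_left (‖w‖ ^ 2)).unique h3
  refine (sq_eq_sq₀ (by positivity) (by positivity)).mp ?_
  rw [← h2]
  simp [mul_pow]

theorem continuous_rankOneHS (w : H) : Continuous (rankOneHS w) := by
  have h : ∀ v v', rankOneHS w v - rankOneHS w v' = rankOneHS w (v - v') := fun v v' =>
    HS.ext_op fun i => by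
      rw [rankOneHS_op_apply, inner_sub_left, sub_smul]
      rfl
  refine LipschitzWith.continuous (K := ‖w‖₊) (LipschitzWith.of_dist_le_mul fun v v' => ?_)
  rw [dist_eq_norm, dist_eq_norm, h, norm_rankOneHS]
  rfl

/-- A continuous linear map on `𝒮²` is determined by its values on a dense set of rank-one
operators. -/
theorem HS.continuousLinearMap_ext {E : Type*} [NormedAddCommGroup E] [NormedSpace ℂ E]
    {V V' : HS H →L[ℂ] E} {D : Set H} (hD : Dense D)
    (h : ∀ w, ∀ v ∈ D, V (rankOneHS w v) = V' (rankOneHS w v)) : V = V' := by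
  classical
  have h1 : ∀ w v, V (rankOneHS w v) = V' (rankOneHS w v) := fun w v =>
    congrFun (Continuous.ext_on hD (V.continuous.comp (continuous_rankOneHS w))
      (V'.continuous.comp (continuous_rankOneHS w)) fun v hv => h w v hv) v
  ext A
  -- The coordinate expansion in ℓ² is A = ∑ (A eᵢ)⊗eᵢ, convergent in the Hilbert–Schmidt norm.
  have h2 := (lp.hasSum_single (p := 2) (by norm_num) (HS.equivLp H A)).mapL
    ((HS.equivLp H).symm.toContinuousLinearEquiv : _ →L[ℂ] HS H)
  have h3 : ∀ i, (HS.equivLp H).symm (lp.single 2 i (HS.equivLp H A i)) =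
      rankOneHS (A.op (onb H i)) (onb H i) := by
    intro i
    rw [LinearIsometryEquiv.symm_apply_eq]
    ext j
    show (lp.single (E := fun _ : BasisIndex H => H) 2 i (A.op (onb H i))) j = (rankOneHS (A.op (onb H i)) (onb H i)).op (onb H j)
    rw [rankOneHS_op_apply, orthonormal_iff_ite.mp (onb H).orthonormal i j]
    by_cases hij : i = j
    · subst hij
      rw [lp.single_apply_self, if_pos rfl, one_smul]
    · rw [lp.single_apply_ne _ _ _ (Ne.symm hij), if_neg hij, zero_smul]
  have h4 : HasSum (fun i => rankOneHS (A.op (onb H i)) (onb H i)) A := by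
    convert h2 using 1
    · funext i
      exact (h3 i).symm
    · exact ((HS.equivLp H).symm_apply_apply A).symm
  have h5 := h4.mapL V
  simp_rw [h1] at h5
  exact h5.unique (h4.mapL V')

end HilbertSchmidt

/-! ### Convergence, countability and density -/

section Convergence

/-- The squared distance from `x` to a partial sum is ‖x‖² minus the partial sum of the ‖g i‖². -/
theorem hasSum_of_orthogonal {ι E : Type*} [NormedAddCommGroup E] [InnerProductSpace ℂ E]
    {g : ι → E} {x : E} (horth : ∀ i j, i ≠ j → inner ℂ (g i) (g j) = 0)
    (hx : ∀ i, inner ℂ (g i) x = inner ℂ (g i) (g i))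
    (hs : HasSum (fun i => ‖g i‖ ^ 2) (‖x‖ ^ 2)) : HasSum g x := by
  classical
  have key : ∀ s : Finset ι, ‖x - ∑ i ∈ s, g i‖ ^ 2 = ‖x‖ ^ 2 - ∑ i ∈ s, ‖g i‖ ^ 2 := by
    intro s
    have h1 : inner ℂ (∑ i ∈ s, g i) x = ∑ i ∈ s, inner ℂ (g i) (g i) := by
      rw [sum_inner]
      exact Finset.sum_congr rfl fun i _ => hx i
    have h2 : inner ℂ (∑ i ∈ s, g i) (∑ i ∈ s, g i) = ∑ i ∈ s, inner ℂ (g i) (g i) := by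
      rw [sum_inner]
      refine Finset.sum_congr rfl fun i hi => ?_
      rw [inner_sum, Finset.sum_eq_single i (fun j _ hj => horth i j hj.symm) (fun h => (h hi).elim)]
    have h3 : ∑ i ∈ s, inner ℂ (g i) (g i) = ((∑ i ∈ s, ‖g i‖ ^ 2 : ℝ) : ℂ) := by
      push_cast
      exact Finset.sum_congr rfl fun i _ => inner_self_eq_norm_sq_to_K _
    have h4 : ‖∑ i ∈ s, g i‖ ^ 2 = ∑ i ∈ s, ‖g i‖ ^ 2 := by
      rw [@norm_sq_eq_re_inner ℂ, h2, h3]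
      exact Complex.ofReal_re _
    rw [@norm_sub_sq ℂ, h4, inner_re_symm, h1, h3, RCLike.re_to_complex, Complex.ofReal_re]
    ring
  rw [HasSum, SummationFilter.unconditional_filter, tendsto_iff_norm_sub_tendsto_zero]
  have h5 : Filter.Tendsto (fun s : Finset ι => ‖x‖ ^ 2 - ∑ i ∈ s, ‖g i‖ ^ 2) Filter.atTop
      (𝓝 0) := by
    have := (tendsto_const_nhds (x := ‖x‖ ^ 2)).sub hs
    rwa [sub_self] at this
  have h6 := (Real.continuous_sqrt.tendsto 0).comp h5
  rw [Real.sqrt_zero] at h6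
  refine h6.congr fun s => ?_
  rw [Function.comp_apply, ← key, Real.sqrt_sq (norm_nonneg _), norm_sub_rev]

/-- Some sequence of partial sums converges almost everywhere to `f`. Countability of `ι` puts the
exceptional sets of all `g i` into one null set. -/
theorem ae_eq_of_hasSum_of_forall_hasSum {α ι : Type*} [MeasurableSpace α] {μ : Measure α}
    [Countable ι] {g : ι → Lp ℂ 2 μ} {f : Lp ℂ 2 μ} {a : ι → α → ℂ} {F : α → ℂ}
    (hg : HasSum g f) (hga : ∀ i, (g i : α → ℂ) =ᵐ[μ] a i)
    (ha : ∀ x, HasSum (fun i => a i x) (F x)) : (f : α → ℂ) =ᵐ[μ] F := by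
  rw [HasSum, SummationFilter.unconditional_filter] at hg
  obtain ⟨s, hs, hae⟩ := (tendstoInMeasure_of_tendsto_Lp hg).exists_seq_tendsto_ae'
  have h1 : ∀ n, ((∑ i ∈ s n, g i : Lp ℂ 2 μ) : α → ℂ) =ᵐ[μ] fun x => ∑ i ∈ s n, a i x := by
    intro n
    refine (Lp.coeFn_finsetSum _ _).trans ?_
    filter_upwards [(ae_all_iff (ι := ι)).mpr hga] with x hx
    rw [Finset.sum_apply]
    exact Finset.sum_congr rfl fun i _ => hx i
  filter_upwards [hae, ae_all_iff.mpr h1] with x hx hx1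
  refine tendsto_nhds_unique hx ?_
  have h2 := ha x
  rw [HasSum, SummationFilter.unconditional_filter] at h2
  refine (h2.comp hs).congr fun n => ?_
  exact (hx1 n).symm

theorem countable_basisIndex (H : Type*) [NormedAddCommGroup H] [InnerProductSpace ℂ H]
    [CompleteSpace H] [TopologicalSpace.SeparableSpace H] : Countable (BasisIndex H) := by
  refine Pairwise.countable_of_isOpen_disjoint (s := fun i => Metric.ball (onb H i) (1 / 2))
    (fun i j hij => ?_) (fun i => Metric.isOpen_ball)
    (fun i => ⟨onb H i, Metric.mem_ball_self (by norm_num)⟩)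
  refine Metric.ball_disjoint_ball ?_
  have h1 : dist (onb H i) (onb H j) ^ 2 = 2 := by
    rw [dist_eq_norm, @norm_sub_sq ℂ, (onb H).orthonormal.inner_eq_zero hij,
      (onb H).orthonormal.norm_eq_one, (onb H).orthonormal.norm_eq_one]
    norm_num
  nlinarith [dist_nonneg (x := onb H i) (y := onb H j)]

/-- Simple functions are dense in L², and those in L² are supported on sets of finite measure, hence
integrable. -/
theorem dense_setOf_integrable {α : Type*} [MeasurableSpace α] (μ : Measure α) :
    Dense {f : Lp ℂ 2 μ | Integrable (f : α → ℂ) μ} := by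
  refine (Lp.simpleFunc.denseRange (E := ℂ) (p := 2) (μ := μ) (by norm_num)).mono ?_
  rintro _ ⟨f, rfl⟩
  have h := (SimpleFunc.memLp_iff_integrable (p := 2) (by norm_num) (by norm_num)).mp
    (Lp.simpleFunc.memLp f)
  exact h.congr (Lp.simpleFunc.toSimpleFunc_eq_toFun f)

end Convergence

/-! ### The Fourier–Wigner transform and its inverse -/

section FourierWigner

variable {G H : Type*} [Group G] [TopologicalSpace G] [IsTopologicalGroup G]
  [MeasurableSpace G] [BorelSpace G]
  [NormedAddCommGroup H] [InnerProductSpace ℂ H] [CompleteSpace H]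
  {π : G →* unitary (H →L[ℂ] H)} {μ : Measure G} {K : H →ₗ.[ℂ] H}

namespace IsDufloMoore

theorem inner_waveletLp (hK : IsDufloMoore π μ K) (φ₁ φ₂ : K.domain) (ψ₁ ψ₂ : H) :
    inner ℂ (waveletLp π μ (Submodule.inclusion hK.domain_eq.le φ₂) ψ₂)
      (waveletLp π μ (Submodule.inclusion hK.domain_eq.le φ₁) ψ₁) =
        inner ℂ ψ₂ ψ₁ * inner ℂ (K φ₁) (K φ₂) := by
  rw [FW.inner_waveletLp, ← inner_conj_symm (K φ₁)]
  exact hK.orthogonality φ₁ φ₂ ψ₁ ψ₂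

theorem norm_waveletLp (hK : IsDufloMoore π μ K) (φ : K.domain) (ψ : H) :
    ‖waveletLp π μ (Submodule.inclusion hK.domain_eq.le φ) ψ‖ = ‖K φ‖ * ‖ψ‖ := by
  have h := hK.inner_waveletLp φ φ ψ ψ
  simp only [inner_self_eq_norm_sq_to_K] at h
  refine (sq_eq_sq₀ (by positivity) (by positivity)).mp ?_
  rw [mul_pow, mul_comm]
  exact_mod_cast h

/-- If K φ = 0, then `W_φ φ` vanishes almost everywhere. It is continuous, so it vanishes at 1,
where its value is ‖φ‖². -/
theorem ker_eq_bot [μ.IsOpenPosMeasure] (hcont : IsStronglyContinuous π)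
    (hK : IsDufloMoore π μ K) : K.toFun.ker = ⊥ := by
  rw [LinearMap.ker_eq_bot']
  intro φ hφ
  have hφ : K φ = 0 := hφ
  have h1 := hK.norm_waveletLp φ φ
  rw [hφ, norm_zero, zero_mul, norm_eq_zero] at h1
  have h2 := waveletLp_ae_eq (Submodule.inclusion hK.domain_eq.le φ) (φ : H)
  rw [h1] at h2
  have h3 : wavelet π (φ : H) φ =ᵐ[μ] fun _ => 0 := h2.symm.trans (Lp.coeFn_zero _ _ _)
  have h4 := congrFun ((continuous_wavelet hcont (φ : H) φ).ae_eq_iff_eq μ continuous_const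
    |>.mp h3) 1
  rw [wavelet_eq, rep_one_apply] at h4
  exact Subtype.ext (inner_self_eq_zero.mp h4)

/-- A vector orthogonal to the range of a self-adjoint operator lies in its kernel. -/
theorem denseRange (hK : IsDufloMoore π μ K) (hker : K.toFun.ker = ⊥) : DenseRange K.toFun := by
  have h : Dense (LinearMap.range K.toFun : Set H) := by
    rw [Submodule.dense_iff_topologicalClosure_eq_top, Submodule.topologicalClosure_eq_top_iff,
      Submodule.eq_bot_iff]
    intro w hw
    rw [Submodule.mem_orthogonal'] at hw
    have h1 : (w, (0 : H)) ∈ K.graph := mem_graph_of_isSelfAdjoint hK.isSelfAdjoint fun x => by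
      rw [inner_zero_left]
      exact (hw _ ⟨x, rfl⟩).symm
    obtain ⟨φ, h2, h3⟩ := K.mem_graph_iff.mp h1
    have h4 := (LinearMap.ker_eq_bot'.mp hker) φ h3
    rw [h4] at h2
    exact h2.symm
  exact h

/-- The wavelet transforms `W_φ`, as an antilinear family of bounded operators. -/
def waveletCLM (hK : IsDufloMoore π μ K) : K.domain →ₛₗ[starRingEnd ℂ] (H →L[ℂ] Lp ℂ 2 μ) where
  toFun φ := (waveletLp π μ (Submodule.inclusion hK.domain_eq.le φ)).mkContinuous ‖K φ‖
    fun ψ => (hK.norm_waveletLp φ ψ).le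
  map_add' a b := by ext1 ψ; simp
  map_smul' c a := by ext1 ψ; simp

/-- The bounded extension of `K φ ↦ W_φ`. -/
def transform (hK : IsDufloMoore π μ K) : H →SL[starRingEnd ℂ] (H →L[ℂ] Lp ℂ 2 μ) :=
  hK.waveletCLM.extendOfNorm K.toFun

theorem transform_apply (hK : IsDufloMoore π μ K) (hker : K.toFun.ker = ⊥) (φ : K.domain) (ψ : H) :
    hK.transform (K φ) ψ = waveletLp π μ (Submodule.inclusion hK.domain_eq.le φ) ψ := by
  have h : hK.transform (K φ) = hK.waveletCLM φ :=
    LinearMap.extendOfNorm_eq (hK.denseRange hker) ⟨1, fun φ => by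
      rw [one_mul]
      exact LinearMap.mkContinuous_norm_le _ (norm_nonneg _)
        fun ψ => (hK.norm_waveletLp φ ψ).le⟩ φ
  rw [h]
  rfl

theorem inner_transform (hK : IsDufloMoore π μ K) (hker : K.toFun.ker = ⊥) (v₁ v₂ ψ₁ ψ₂ : H) :
    inner ℂ (hK.transform v₂ ψ₂) (hK.transform v₁ ψ₁) = inner ℂ ψ₂ ψ₁ * inner ℂ v₁ v₂ := by
  have hc : ∀ ψ, Continuous fun v => hK.transform v ψ := fun ψ =>
    (ContinuousLinearMap.apply ℂ _ ψ).continuous.comp hK.transform.continuous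
  refine (hK.denseRange hker).induction_on₂ (p := fun v₁ v₂ =>
    inner ℂ (hK.transform v₂ ψ₂) (hK.transform v₁ ψ₁) = inner ℂ ψ₂ ψ₁ * inner ℂ v₁ v₂) ?_ ?_ v₁ v₂
  · have h1 := hc ψ₁
    have h2 := hc ψ₂
    refine isClosed_eq ?_ ?_
    · exact (h2.comp continuous_snd).inner (h1.comp continuous_fst)
    · exact continuous_const.mul (continuous_fst.inner continuous_snd)
  · intro φ₁ φ₂
    show inner ℂ (hK.transform (K φ₂) ψ₂) (hK.transform (K φ₁) ψ₁) = _
    rw [hK.transform_apply hker, hK.transform_apply hker, hK.inner_waveletLp]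
    rfl

theorem norm_transform (hK : IsDufloMoore π μ K) (hker : K.toFun.ker = ⊥) (v ψ : H) :
    ‖hK.transform v ψ‖ = ‖v‖ * ‖ψ‖ := by
  have h := hK.inner_transform hker v v ψ ψ
  simp only [inner_self_eq_norm_sq_to_K] at h
  refine (sq_eq_sq₀ (by positivity) (by positivity)).mp ?_
  rw [mul_pow, mul_comm]
  exact_mod_cast h

/-- The isometries `ψ ↦ J(eᵢ, ψ)` given by the orthonormal basis. -/
def basisIsometry (hK : IsDufloMoore π μ K) (hker : K.toFun.ker = ⊥) (i : BasisIndex H) :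
    H →ₗᵢ[ℂ] Lp ℂ 2 μ where
  toLinearMap := (hK.transform (onb H i) : H →ₗ[ℂ] Lp ℂ 2 μ)
  norm_map' ψ := by
    show ‖hK.transform (onb H i) ψ‖ = ‖ψ‖
    rw [hK.norm_transform hker, (onb H).orthonormal.norm_eq_one, one_mul]

theorem basisIsometry_apply (hK : IsDufloMoore π μ K) (hker : K.toFun.ker = ⊥) (i : BasisIndex H)
    (ψ : H) : hK.basisIsometry hker i ψ = hK.transform (onb H i) ψ := rfl

theorem orthogonalFamily (hK : IsDufloMoore π μ K) (hker : K.toFun.ker = ⊥) :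
    OrthogonalFamily ℂ (fun _ : BasisIndex H => H) (hK.basisIsometry hker) := by
  intro i j hij v w
  rw [basisIsometry_apply, basisIsometry_apply, hK.inner_transform hker,
    (onb H).orthonormal.inner_eq_zero hij.symm, mul_zero]

/-- The extended Fourier-Wigner transform. -/
def fourierWignerCLM (hK : IsDufloMoore π μ K) (hker : K.toFun.ker = ⊥) : HS H →L[ℂ] Lp ℂ 2 μ :=
  (hK.orthogonalFamily hker).linearIsometry.toContinuousLinearMap ∘L
    ((HS.equivLp H).toContinuousLinearEquiv : HS H →L[ℂ] _)

/-- The extended inverse Fourier-Wigner transform. -/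
def invFourierWignerCLM (hK : IsDufloMoore π μ K) (hker : K.toFun.ker = ⊥) :
    Lp ℂ 2 μ →L[ℂ] HS H :=
  ((HS.equivLp H).symm.toContinuousLinearEquiv : _ →L[ℂ] HS H) ∘L
    ContinuousLinearMap.adjoint (hK.orthogonalFamily hker).linearIsometry.toContinuousLinearMap

theorem norm_fourierWignerCLM (hK : IsDufloMoore π μ K) (hker : K.toFun.ker = ⊥) (A : HS H) :
    ‖hK.fourierWignerCLM hker A‖ = ‖A‖ := by
  show ‖(hK.orthogonalFamily hker).linearIsometry (HS.equivLp H A)‖ = ‖A‖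
  rw [LinearIsometry.norm_map, LinearIsometryEquiv.norm_map]

theorem invFourierWignerCLM_apply_fourierWignerCLM (hK : IsDufloMoore π μ K)
    (hker : K.toFun.ker = ⊥) (A : HS H) :
    hK.invFourierWignerCLM hker (hK.fourierWignerCLM hker A) = A := by
  let L := (hK.orthogonalFamily hker).linearIsometry
  show (HS.equivLp H).symm (ContinuousLinearMap.adjoint L.toContinuousLinearMap
    (L.toContinuousLinearMap (HS.equivLp H A))) = A
  have h : ContinuousLinearMap.adjoint L.toContinuousLinearMap
      (L.toContinuousLinearMap (HS.equivLp H A)) = HS.equivLp H A := by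
    refine ext_inner_left ℂ fun w => ?_
    rw [ContinuousLinearMap.adjoint_inner_right]
    exact L.inner_map_map _ _
  rw [h, LinearIsometryEquiv.symm_apply_apply]

/-- Expanding both sides over the basis, the terms match by `inner_transform`. As `v` is arbitrary,
this frees the transform from the basis defining it and allows pairing with v = A* eᵢ. -/
theorem inner_fourierWignerCLM (hK : IsDufloMoore π μ K) (hker : K.toFun.ker = ⊥) (A : HS H)
    (v ψ : H) : inner ℂ (hK.transform v ψ) (hK.fourierWignerCLM hker A) = inner ℂ ψ (A.op v) := by
  have h1 : HasSum (fun i => hK.transform (onb H i) (A.op (onb H i)))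
      (hK.fourierWignerCLM hker A) :=
    (hK.orthogonalFamily hker).hasSum_linearIsometry (HS.equivLp H A)
  have h2 := h1.mapL (innerSL ℂ (hK.transform v ψ))
  have h3 := (((onb H).hasSum_repr v).mapL A.op).mapL (innerSL ℂ ψ)
  refine h2.unique ?_
  refine HasSum.congr_fun h3 fun i => ?_
  rw [innerSL_apply_apply, innerSL_apply_apply, hK.inner_transform hker, map_smul,
    inner_smul_right, (onb H).repr_apply_apply, mul_comm]

/-- For basis vectors `v` this is the definition of the adjoint. Both sides are linear and
continuous in `v`, the antilinearity of `transform` cancelling that of the first slot. -/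
theorem inner_invFourierWignerCLM (hK : IsDufloMoore π μ K) (hker : K.toFun.ker = ⊥)
    (f : Lp ℂ 2 μ) (v ψ : H) :
    inner ℂ ψ ((hK.invFourierWignerCLM hker f).op v) = inner ℂ (hK.transform v ψ) f := by
  classical
  let L := (hK.orthogonalFamily hker).linearIsometry
  have hb : ∀ i, inner ℂ ψ ((hK.invFourierWignerCLM hker f).op (onb H i)) =
      inner ℂ (hK.transform (onb H i) ψ) f := by
    intro i
    have h1 : (hK.invFourierWignerCLM hker f).op (onb H i) =
        ContinuousLinearMap.adjoint L.toContinuousLinearMap f i := by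
      rw [← HS.equivLp_apply]
      show (HS.equivLp H) ((HS.equivLp H).symm _) i = _
      rw [LinearIsometryEquiv.apply_symm_apply]
      rfl
    have h2 := lp.inner_single_left (𝕜 := ℂ) (G := fun _ : BasisIndex H => H) i ψ
      (ContinuousLinearMap.adjoint L.toContinuousLinearMap f)
    rw [h1]
    refine h2.symm.trans ?_
    rw [ContinuousLinearMap.adjoint_inner_right]
    congr 1
    exact (hK.orthogonalFamily hker).linearIsometry_apply_single ψ
  let F : H →+ ℂ := AddMonoidHom.mk' (fun v => inner ℂ (hK.transform v ψ) f)
    fun a b => by simp [inner_add_left]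
  have hF : Continuous F :=
    ((ContinuousLinearMap.apply ℂ _ ψ).continuous.comp hK.transform.continuous).inner
      continuous_const
  have h2 := ((onb H).hasSum_repr v).map F hF
  have h3 := (((onb H).hasSum_repr v).mapL (hK.invFourierWignerCLM hker f).op).mapL (innerSL ℂ ψ)
  refine h3.unique (HasSum.congr_fun h2 fun i => ?_)
  rw [innerSL_apply_apply, map_smul, inner_smul_right, hb]
  show _ = inner ℂ (hK.transform (_ • onb H i) ψ) f
  rw [map_smulₛₗ, smul_apply, inner_smul_left, Complex.conj_conj]

theorem apply_eq_of_mem_S1Dinv (hker : K.toFun.ker = ⊥) {A : HS H} {T : H →L[ℂ] H}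
    (hT : ∀ φ : K.inverse.domain, T (φ : H) = A.op (K.inverse φ)) (φ : K.domain) :
    T (K φ) = A.op φ := by
  have hmem : K φ ∈ K.inverse.domain := by
    rw [LinearPMap.inverse_domain]
    exact ⟨φ, rfl⟩
  have h := hT ⟨K φ, hmem⟩
  rwa [LinearPMap.inverse_apply_eq hker (x := φ) rfl] at h

theorem extendsFW [TopologicalSpace.SeparableSpace H] (hK : IsDufloMoore π μ K)
    (hker : K.toFun.ker = ⊥) : ExtendsFW π μ K (hK.fourierWignerCLM hker) := by
  intro A hA
  set T := hA.choose with hTdef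
  have hTtr : IsTraceClass T := hA.choose_spec.1
  have hTK : ∀ φ : K.domain, T (K φ) = A.op φ :=
    apply_eq_of_mem_S1Dinv hker hA.choose_spec.2
  -- Since T K = A on Dom K and `K` is self-adjoint, T* u lies in Dom K and K T* u = A* u.
  have hgraph : ∀ u, (ContinuousLinearMap.adjoint T u, ContinuousLinearMap.adjoint A.op u) ∈
      K.graph := by
    intro u
    refine mem_graph_of_isSelfAdjoint hK.isSelfAdjoint fun x => ?_
    rw [ContinuousLinearMap.adjoint_inner_left, ContinuousLinearMap.adjoint_inner_left, hTK]
  choose χ hχ1 hχ2 using fun u => K.mem_graph_iff.mp (hgraph u)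
  simp only at hχ1 hχ2
  -- This is the wavelet transform of eᵢ with window T* eᵢ; at x it equals ⟨eᵢ, T π(x) eᵢ⟩ in
  -- Mathlib's convention, the i-th term of the trace.
  let g : BasisIndex H → Lp ℂ 2 μ := fun i =>
    waveletLp π μ (Submodule.inclusion hK.domain_eq.le (χ (onb H i))) (onb H i)
  have hg : ∀ i, g i = hK.transform (ContinuousLinearMap.adjoint A.op (onb H i)) (onb H i) := by
    intro i
    rw [← hχ2, hK.transform_apply hker]
  have hself : ∀ i, inner ℂ (g i) (g i) =
      inner ℂ (ContinuousLinearMap.adjoint A.op (onb H i))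
        (ContinuousLinearMap.adjoint A.op (onb H i)) := by
    intro i
    rw [hg, hK.inner_transform hker, inner_self_eq_norm_sq_to_K (onb H i),
      (onb H).orthonormal.norm_eq_one]
    simp
  -- The `g i` are orthogonal because the eᵢ are, and ‖g i‖ = ‖A* eᵢ‖, so their squares sum to ‖A‖².
  have hsum : HasSum g (hK.fourierWignerCLM hker A) := by
    refine hasSum_of_orthogonal (fun i j hij => ?_) (fun i => ?_) ?_
    · rw [hg, hg, hK.inner_transform hker, (onb H).orthonormal.inner_eq_zero hij, zero_mul]
    · rw [hself]
      rw [hg, hK.inner_fourierWignerCLM hker, ContinuousLinearMap.adjoint_inner_left]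
    · rw [hK.norm_fourierWignerCLM hker]
      convert A.hasSum_norm_sq_adjoint using 1
      funext i
      rw [hg, hK.norm_transform hker, (onb H).orthonormal.norm_eq_one, mul_one]
  have := countable_basisIndex H
  refine ae_eq_of_hasSum_of_forall_hasSum hsum (fun i => waveletLp_ae_eq _ _) fun x => ?_
  have h1 := (hTtr.summable_mul (π x : H →L[ℂ] H)).hasSum
  refine HasSum.congr_fun h1 fun i => ?_
  rw [wavelet_eq, Submodule.coe_inclusion, hχ1, ContinuousLinearMap.adjoint_inner_left]
  rfl

/-- Symmetry of `K` moves it off χ and cancels 𝒟, so (w⊗Kχ)𝒟 extends to w⊗χ. As `K` has dense range,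
these operators suffice for uniqueness of the transform. -/
theorem rankOneHS_mem_S1Dinv (hK : IsDufloMoore π μ K) (hker : K.toFun.ker = ⊥) (w : H)
    (χ : K.domain) : rankOneHS w (K χ) ∈ S1Dinv K := by
  refine ⟨InnerProductSpace.rankOne ℂ w χ, isTraceClass_rankOne w χ, fun φ => ?_⟩
  obtain ⟨η, hη⟩ : (φ : H) ∈ LinearMap.range K.toFun := by
    rw [← LinearPMap.inverse_domain]
    exact φ.2
  have hη : K η = φ := hη
  rw [LinearPMap.inverse_apply_eq hker hη, rankOneHS_op_apply, InnerProductSpace.rankOne_apply,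
    inner_symm_of_isSelfAdjoint hK.isSelfAdjoint, hη]

theorem eq_of_extendsFW (hK : IsDufloMoore π μ K) (hker : K.toFun.ker = ⊥)
    {V V' : HS H →L[ℂ] Lp ℂ 2 μ} (hV : ExtendsFW π μ K V) (hV' : ExtendsFW π μ K V') : V = V' := by
  refine HS.continuousLinearMap_ext (hK.denseRange hker) ?_
  rintro w _ ⟨χ, rfl⟩
  have hmem := hK.rankOneHS_mem_S1Dinv hker w χ
  exact Lp.ext ((hV _ hmem).trans (hV' _ hmem).symm)

theorem extendsInvFW [SecondCountableTopology G] (hcont : IsStronglyContinuous π)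
    (hK : IsDufloMoore π μ K) (hker : K.toFun.ker = ⊥) :
    ExtendsInvFW π μ K (hK.invFourierWignerCLM hker) := by
  intro f hf φ
  obtain ⟨χ, hχ⟩ : (φ : H) ∈ LinearMap.range K.toFun := by
    rw [← LinearPMap.inverse_domain]
    exact φ.2
  have hχ : K χ = φ := hχ
  have hc : Continuous fun x : G => (π x⁻¹ : H →L[ℂ] H) χ := (hcont (χ : H)).comp continuous_inv
  have hint : Integrable (fun x => f x • (π x⁻¹ : H →L[ℂ] H) χ) μ := by
    refine Integrable.mono' (hf.norm.mul_const ‖(χ : H)‖)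
      (hf.aestronglyMeasurable.smul hc.aestronglyMeasurable) (Filter.Eventually.of_forall fun x => ?_)
    rw [norm_smul, norm_rep_apply]
  -- The substitution x ↦ x⁻¹ turns the left Haar integral into one against `μ`.
  have hinv : invFourierWigner π μ K f φ = ∫ x, f x • (π x⁻¹ : H →L[ℂ] H) χ ∂μ := by
    rw [invFourierWigner, integratedRep, LinearPMap.inverse_apply_eq hker hχ, Measure.inv_def]
    have := integral_map_equiv (MeasurableEquiv.inv G) (μ := μ)
      (fun x => f x⁻¹ • (π x : H →L[ℂ] H) χ)
    refine this.trans ?_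
    congr 1
    funext x
    simp
  rw [hinv]
  -- Tested against ψ, both sides become the L² pairing of `W_χ ψ` with `f`, since 𝒟 φ = χ.
  refine ext_inner_left ℂ fun ψ => ?_
  rw [hK.inner_invFourierWignerCLM hker, ← hχ, hK.transform_apply hker, L2.inner_def,
    ← integral_inner hint]
  refine integral_congr_ae ?_
  filter_upwards [waveletLp_ae_eq (Submodule.inclusion hK.domain_eq.le χ) ψ] with x hx
  rw [hx, wavelet_eq, inner_smul_right, Submodule.coe_inclusion, ← inner_rep_left,
    ← inner_conj_symm ((π x : H →L[ℂ] H) ψ)]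
  rfl

/-- The formula fixes each operator on Dom 𝒟, the dense range of `K`, for every f in the dense
subspace L¹ ∩ L². -/
theorem eq_of_extendsInvFW (hK : IsDufloMoore π μ K) (hker : K.toFun.ker = ⊥)
    {U U' : Lp ℂ 2 μ →L[ℂ] HS H} (hU : ExtendsInvFW π μ K U) (hU' : ExtendsInvFW π μ K U') :
    U = U' := by
  refine ContinuousLinearMap.ext fun f => ?_
  refine congrFun (Continuous.ext_on (dense_setOf_integrable μ) U.continuous U'.continuous
    fun f hf => HS.ext_op fun i => ?_) f
  refine congrFun (Continuous.ext_on (hK.denseRange hker) (U f).op.continuous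
    (U' f).op.continuous ?_) (onb H i)
  rintro _ ⟨χ, rfl⟩
  have hmem : K χ ∈ K.inverse.domain := by
    rw [LinearPMap.inverse_domain]
    exact ⟨χ, rfl⟩
  exact (hU f hf ⟨K χ, hmem⟩).trans (hU' f hf ⟨K χ, hmem⟩).symm

end IsDufloMoore

end FourierWigner

end FW

end

theorem proposition3p3 {G H : Type*} [Group G] [TopologicalSpace G] [IsTopologicalGroup G]
    [LocallyCompactSpace G] [T2Space G] [SecondCountableTopology G]
    [MeasurableSpace G] [BorelSpace G]
    (μ : Measure G) [μ.IsMulRightInvariant] [IsFiniteMeasureOnCompacts μ] [μ.IsOpenPosMeasure]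
    [NormedAddCommGroup H] [InnerProductSpace ℂ H] [CompleteSpace H]
    [TopologicalSpace.SeparableSpace H]
    (π : G →* unitary (H →L[ℂ] H)) (hcont : FW.IsStronglyContinuous π)
    (hirr : FW.IsIrreducible π) (hsq : FW.IsSquareIntegrable π μ) :
    (∃! K : H →ₗ.[ℂ] H, FW.IsDufloMoore π μ K) ∧
    ∀ K : H →ₗ.[ℂ] H, FW.IsDufloMoore π μ K →
      ∃ V : FW.HS H →L[ℂ] Lp ℂ 2 μ, ∃ U : Lp ℂ 2 μ →L[ℂ] FW.HS H,
        (FW.ExtendsFW π μ K V ∧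
          ∀ V' : FW.HS H →L[ℂ] Lp ℂ 2 μ, FW.ExtendsFW π μ K V' → V' = V) ∧
        (FW.ExtendsInvFW π μ K U ∧
          ∀ U' : Lp ℂ 2 μ →L[ℂ] FW.HS H, FW.ExtendsInvFW π μ K U' → U' = U) ∧
        (∀ A : FW.HS H, ‖V A‖ = ‖A‖) ∧
        Function.Injective V ∧
        (∀ A : FW.HS H, U (V A) = A) := by
  refine ⟨?_, fun K hK => ?_⟩
  · obtain ⟨K, hK⟩ := FW.exists_isDufloMoore hirr hsq
    exact ⟨K, hK, fun K' hK' => hK'.unique hirr hK⟩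
  · have hker := hK.ker_eq_bot hcont
    refine ⟨hK.fourierWignerCLM hker, hK.invFourierWignerCLM hker,
      ⟨hK.extendsFW hker, fun V hV => hK.eq_of_extendsFW hker hV (hK.extendsFW hker)⟩,
      ⟨hK.extendsInvFW hcont hker,
        fun U hU => hK.eq_of_extendsInvFW hker hU (hK.extendsInvFW hcont hker)⟩,
      hK.norm_fourierWignerCLM hker, ?_, hK.invFourierWignerCLM_apply_fourierWignerCLM hker⟩
    exact Function.LeftInverse.injective (hK.invFourierWignerCLM_apply_fourierWignerCLM hker)
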